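/- Let $m,d\ge 0$ and let $V\in\mathbb R[x_1,\dots,x_m]$ be a homogeneous polynomial of degree $d$. Say that $V$ satisfies $(\ast)_d$ if for every $k=0,\dots,d-1$ and every homogeneous differential operator $D=\sum_{i_1+\dots+i_m=k}d_{i_1,\dots,i_m}\partial_1^{i_1}\cdots\partial_m^{i_m}$ with constant real coefficients and of degree $k$, if the polynomial $DV$ is non-zero, then $DV$ takes both a positive and a negative value on $\mathbb R^m$. The condition $(\ast)_d$ is algorithmically verifiable, namely: (a) There is an algorithm (a computable function) which, given $(m,d)$, outputs a quantifier-free formula $\Phi_{m,d}$, that is, a finite Boolean combination of conditions $p=0$ and $p>0$, where the $p$ are polynomials with integer coefficients in the coefficients of a form of degree $d$ in $m$ variables, such that a homogeneous $V\in\mathbb R[x_1,\dots,x_m]$ of degree $d$ satisfies $(\ast)_d$ if and only if its coefficients satisfy $\Phi_{m,d}$. (b) There is an algorithm which, given $(m,d)$ and the list of terms of a homogeneous polynomial $V$ of degree $d$ in $m$ variables with rational coefficients, decides whether $V$ satisfies $(\ast)_d$. (c) Let $M^{2n}=M(P,\Lambda)$ be the quasitoric manifold given by a simple polytope $P\subset\mathbb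 R^n$ of dimension $n$ with facets $F_1,\dots,F_m$ and by an integer $n\times m$ matrix $\Lambda$ with columns $\lambda_1,\dots,\lambda_m$ such that $\lambda_{i_1},\dots,\lambda_{i_n}$ is a basis of $\mathbb Z^n$ whenever $F_{i_1}\cap\dots\cap F_{i_n}$ is a vertex. Let $$V_{\mathcal F}(c_1,\dots,c_m)=\frac1{n!}\big\langle(c_1x_1+\dots+c_mx_m)^n,[M^{2n}]\big\rangle$$ be the volume polynomial of the multifan $\mathcal F$ of $M^{2n}$, where $H^*(M^{2n};\mathbb R)=\mathbb R[x_1,\dots,x_m]/(I_H+J_H)$, the ideal $I_H$ is generated by the monomials $x_{i_1}\cdots x_{i_k}$ with $F_{i_1}\cap\dots\cap F_{i_k}=\varnothing$, the ideal $J_H$ is generated by the linear forms $\sum_j\lambda_i^jx_j$, $i=1,\dots,n$, and $[M^{2n}]$ is the fundamental class, for which $\langle x_{i_1}\cdots x_{i_n},[M^{2n}]\rangle=\det(\lambda_{i_1},\dots,\lambda_{i_n})$ if $F_{i_1},\dots,F_{i_n}$ meet in a vertex and their inward-pointing normal vectors, in this order, form a positive basis of $\mathbb R^n$ (and minus this determinant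 if they form a negative basis). There is an algorithm which, given $n$, $m$, the matrix $\Lambda$ and the list of the vertices of $P$ (for each vertex: the indices of the facets through it, in some order, and whether the respective inward normals form a positive basis in this order), decides whether $V_{\mathcal F}$ satisfies $(\ast)_n$. -/

import Mathlib

noncomputable section

namespace VolumePolynomial

/-! ### Differential operators with constant coefficients and the sign condition -/

/-- The monomial operator `∂₁^(α₁) ⋯ ∂ₘ^(αₘ)` applied to `V`. -/
def monomialDeriv {m : ℕ} (α : Fin m →₀ ℕ) (V : MvPolynomial (Fin m) ℝ) :
    MvPolynomial (Fin m) ℝ :=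
  (List.finRange m).foldr (fun i W => (MvPolynomial.pderiv i)^[α i] W) V

/-- The action on polynomials of the operator `∑ d_α ∂^α` with constant real coefficients, where
the operator is written as the polynomial `D = ∑ d_α ξ^α` in the symbols `ξᵢ = ∂ᵢ`. -/
def applyDiffOp {m : ℕ} (D V : MvPolynomial (Fin m) ℝ) : MvPolynomial (Fin m) ℝ :=
  ∑ α ∈ D.support, D.coeff α • monomialDeriv α V

/-- For every homogeneous differential operator `D` of degree `k = 0, …, d - 1` with constant real
coefficients, if the polynomial `D V` is nonzero, then it takes values of opposite signs. -/
def DerivativesChangeSign {m : ℕ} (d : ℕ) (V : MvPolynomial (Fin m) ℝ) : Prop :=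
  ∀ k < d, ∀ D : MvPolynomial (Fin m) ℝ, D.IsHomogeneous k → applyDiffOp D V ≠ 0 →
    (∃ x : Fin m → ℝ, 0 < MvPolynomial.eval x (applyDiffOp D V)) ∧
      ∃ y : Fin m → ℝ, MvPolynomial.eval y (applyDiffOp D V) < 0

/-! ### Finite codes for polynomials and for sign conditions on coefficients -/

/-- The exponent vector in `m` variables listed by `l` (padded by zeros, or cut off). -/
def exponent (m : ℕ) (l : List ℕ) : Fin m →₀ ℕ :=
  Finsupp.equivFunOnFinite.symm fun i => l.getD (i : ℕ) 0

/-- A polynomial with rational coefficients as a list of terms: `(l, p, q)` stands for the monomial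
with exponent vector `l` and coefficient `p / (q + 1)`. -/
abbrev PolyCode : Type := List (List ℕ × ℤ × ℕ)

/-- The polynomial in `m` variables described by a code. -/
def PolyCode.toPoly (m : ℕ) (c : PolyCode) : MvPolynomial (Fin m) ℝ :=
  (c.map fun t => MvPolynomial.monomial (exponent m t.1) ((t.2.1 : ℝ) / ((t.2.2 : ℝ) + 1))).sum

/-- A polynomial with integer coefficients in indeterminates `a_α`, one for every exponent vector
`α`, as a list of terms: `(z, [α₁, …, αᵣ])` stands for `z * a_{α₁} * ⋯ * a_{αᵣ}`. -/
abbrev CoeffPoly : Type := List (ℤ × List (List ℕ))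

/-- The value of such a polynomial when `a_α` is the coefficient of `V` at the monomial `α`. -/
def CoeffPoly.value {m : ℕ} (V : MvPolynomial (Fin m) ℝ) (p : CoeffPoly) : ℝ :=
  (p.map fun t => (t.1 : ℝ) * (t.2.map fun l => V.coeff (exponent m l)).prod).sum

/-- A quantifier-free formula in disjunctive normal form: a finite disjunction of finite
conjunctions of atoms, where `(true, p)` is the atom `p > 0` and `(false, p)` is `p = 0`. -/
abbrev SignFormula : Type := List (List (Bool × CoeffPoly))

/-- The coefficients of `V` satisfy the formula. -/
def SignFormula.Holds {m : ℕ} (V : MvPolynomial (Fin m) ℝ) (Φ : SignFormula) : Prop :=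
  ∃ conj ∈ Φ, ∀ a ∈ conj,
    (a.1 = true ∧ 0 < CoeffPoly.value V a.2) ∨ (a.1 = false ∧ CoeffPoly.value V a.2 = 0)

/-! ### Quasitoric manifolds and their volume polynomials -/

/-- A polyhedron `{x ∈ ℝⁿ | ⟨aᵢ, x⟩ + bᵢ ≥ 0, i = 1, …, m}`. -/
def polyhedron {n m : ℕ} (a : Fin m → Fin n → ℝ) (b : Fin m → ℝ) : Set (Fin n → ℝ) :=
  {x | ∀ i, 0 ≤ a i ⬝ᵥ x + b i}

/-- The indices of the inequalities that are equalities at `x`. -/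
def activeSet {n m : ℕ} (a : Fin m → Fin n → ℝ) (b : Fin m → ℝ) (x : Fin n → ℝ) :
    Set (Fin m) :=
  {i | a i ⬝ᵥ x + b i = 0}

/-- A characteristic pair `(P, Λ)`, which defines a quasitoric manifold `M(P, Λ)` of dimension
`2n`: a simple `n`-dimensional polytope `P ⊆ ℝⁿ` with `m` facets `F₁, …, Fₘ` whose inward-pointing
normal vectors are the `normal i`, and an integer `n × m` matrix `Λ` such that, whenever
`F_{i₁}, …, F_{iₙ}` meet in a vertex, the columns `λ_{i₁}, …, λ_{iₙ}` form a basis of `ℤⁿ`. -/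
structure CharacteristicPair (n m : ℕ) where
  normal : Fin m → Fin n → ℝ
  offset : Fin m → ℝ
  bounded : Bornology.IsBounded (polyhedron normal offset)
  /-- `P` has an interior point. -/
  full_dim : ∃ x : Fin n → ℝ, ∀ i, 0 < normal i ⬝ᵥ x + offset i
  /-- Every inequality defines a facet, and different inequalities define different facets. -/
  facet : ∀ i, ∃ x ∈ polyhedron normal offset, activeSet normal offset x = {i}
  /-- `P` is simple: every vertex lies on exactly `n` facets. -/
  simple : ∀ x ∈ (polyhedron normal offset).extremePoints ℝ,
    (activeSet normal offset x).ncard = n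
  charMatrix : Matrix (Fin n) (Fin m) ℤ
  unimodular : ∀ x ∈ (polyhedron normal offset).extremePoints ℝ, ∀ I : Fin n → Fin m,
    Set.range I = activeSet normal offset x → IsUnit (charMatrix.submatrix id I).det

namespace CharacteristicPair

variable {n m : ℕ} (Q : CharacteristicPair n m)

/-- The moment polytope `P`. -/
def polytope : Set (Fin n → ℝ) := polyhedron Q.normal Q.offset

/-- The facet `Fᵢ` of `P`. -/
def facetSet (i : Fin m) : Set (Fin n → ℝ) :=
  {x ∈ Q.polytope | Q.normal i ⬝ᵥ x + Q.offset i = 0}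

/-- `F_{I 1}, …, F_{I n}` are the facets through a vertex of `P`, in some order. -/
def IsVertexTuple (I : Fin n → Fin m) : Prop :=
  ∃ x ∈ Q.polytope.extremePoints ℝ, Set.range I = activeSet Q.normal Q.offset x

/-- The determinant of the inward-pointing normal vectors of the facets `F_{I 1}, …, F_{I n}`. -/
def normalDet (I : Fin n → Fin m) : ℝ := (Matrix.of fun k => Q.normal (I k)).det

/-- The sign of the fixed point over the vertex with facets `F_{I 1}, …, F_{I n}`: it equals
`det (λ_{I 1}, …, λ_{I n})` if the normal vectors of these facets, in this order, form a positive
basis of `ℝⁿ`. (The formula below does not depend on the order.) -/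
def fixedPointSign (I : Fin n → Fin m) : ℝ :=
  Real.sign (Q.normalDet I) * ((Q.charMatrix.submatrix id I).det : ℝ)

/-- The ideal `I_H + J_H` of relations between the classes `x₁, …, xₘ ∈ H²(M; ℝ)`: `I_H` is
generated by the monomials `x_{i₁} ⋯ x_{iₖ}` with `F_{i₁} ∩ ⋯ ∩ F_{iₖ} = ∅`, and `J_H` by the
linear forms `λ_i¹ x₁ + ⋯ + λ_iᵐ xₘ`, `i = 1, …, n`. -/
def relations : Ideal (MvPolynomial (Fin m) ℝ) :=
  Ideal.span {p | ∃ S : Finset (Fin m), (Q.polytope ∩ ⋂ i ∈ S, Q.facetSet i) = ∅ ∧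
      p = ∏ i ∈ S, MvPolynomial.X i} ⊔
    Ideal.span {p | ∃ i : Fin n,
      p = ∑ j, MvPolynomial.C (Q.charMatrix i j : ℝ) * MvPolynomial.X j}

/-- The cohomology ring `H^*(M; ℝ) = ℝ[x₁, …, xₘ] / (I_H + J_H)`. -/
abbrev Cohomology : Type := MvPolynomial (Fin m) ℝ ⧸ Q.relations

/-- The class `xᵢ ∈ H²(M; ℝ)` dual to the characteristic submanifold over the facet `Fᵢ`. -/
def cls (i : Fin m) : Q.Cohomology := Ideal.Quotient.mk Q.relations (MvPolynomial.X i)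

/-- `φ` is the evaluation `⟨·, [M]⟩` on the fundamental class: it vanishes on classes of degree
other than `2n`, and if `F_{i₁}, …, F_{iₙ}` meet in a vertex, then `⟨x_{i₁} ⋯ x_{iₙ}, [M]⟩` is the
intersection number of the respective characteristic submanifolds, which is the sign of their only
common point. -/
structure IsFundamentalClass (φ : Q.Cohomology →ₗ[ℝ] ℝ) : Prop where
  degree : ∀ (k : ℕ) (p : MvPolynomial (Fin m) ℝ), k ≠ n → p.IsHomogeneous k →
    φ (Ideal.Quotient.mk Q.relations p) = 0
  vertex : ∀ I : Fin n → Fin m, Q.IsVertexTuple I → φ (∏ k, Q.cls (I k)) = Q.fixedPointSign I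

/-- `V` is the volume polynomial of the multifan of `M`:
`V(c₁, …, cₘ) = (1 / n!) ⟨(c₁ x₁ + ⋯ + cₘ xₘ)ⁿ, [M]⟩`. -/
def IsVolumePolynomial (V : MvPolynomial (Fin m) ℝ) : Prop :=
  ∃ φ : Q.Cohomology →ₗ[ℝ] ℝ, Q.IsFundamentalClass φ ∧
    ∀ c : Fin m → ℝ,
      MvPolynomial.eval c V = (1 / (n.factorial : ℝ)) * φ ((∑ i, c i • Q.cls i) ^ n)

/-- The finite data from which an algorithm can start: the dimension `n`, the number `m` of facets,
the list of vertices and the rows of the characteristic matrix. -/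
abbrev Code : Type := ℕ × ℕ × List (List ℕ × Bool) × List (List ℤ)

/-- The list `vs` describes the vertices of `P`: each entry consists of the facets through one
vertex, in some order, together with the information whether their inward-pointing normal vectors
form a positive basis in this order; and every vertex is listed. -/
def IsVertexList (vs : List (List ℕ × Bool)) : Prop :=
  (∀ e ∈ vs, ∃ I : Fin n → Fin m, Q.IsVertexTuple I ∧
      e.1 = List.ofFn (fun k => (I k : ℕ)) ∧ (e.2 = true ↔ 0 < Q.normalDet I)) ∧
    ∀ x ∈ Q.polytope.extremePoints ℝ, ∃ e ∈ vs, ∃ I : Fin n → Fin m,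
      Set.range I = activeSet Q.normal Q.offset x ∧ e.1 = List.ofFn (fun k => (I k : ℕ))

/-- `c` is a code of the characteristic pair. -/
def IsCode (c : Code) : Prop :=
  ∃ vs, Q.IsVertexList vs ∧
    c = (n, m, vs, List.ofFn fun i => List.ofFn fun j => Q.charMatrix i j)

end CharacteristicPair

end VolumePolynomial

end

/-!
The condition says that no nonzero derivative `D V` of order less than `d` is semidefinite; as `D`
may be replaced by `-D`, it says that there are no order `k < d` and no operator `D` of order `k`
for which `D V` has a negative value and no positive one (`derivativesChangeSign_iff`). This is a
first-order statement about the ordered field of real numbers in the coefficients of `V`: the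
quantified variables are the coefficients of `D` and the coordinates of points, and the value of
`D V` at a point is an integer polynomial in all of these (`ev_genericDerivative`). Quantifier
elimination therefore yields the formula (`holds_changeSignFormula`).

Quantifiers are eliminated by sign diagrams, as in the method of Cohen and Hörmander. Polynomials in
one variable, with polynomials in the parameters as coefficients, are collected in a family that is
closed under derivatives, under pseudo-remainders, and under removal of the leading term. Given
the signs of the leading coefficients of its members, the decomposition of the line by their
roots, with the signs of all members on the resulting points and intervals, is determined without
knowing the parameters (`ofSigns_correct`). To see this, the members are inserted in the order of
increasing formal degree. At a point of the decomposition some earlier member `q` has a root, and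
the new member has there the sign of its pseudo-remainder by `q`; on an interval its derivative has
a constant sign, so that the signs at the two ends decide whether there is a root inside. An
existential quantifier becomes the disjunction over those assignments of signs to the leading
coefficients whose diagram has a column with the required signs (`sat_elim`).

For rational coefficients the formula is evaluated in integers, after multiplication by a common
denominator (`PolyCode.decideChangeSign_iff`). For a quasitoric manifold, `n! V` is the sum
over all words of `n` facets of the corresponding monomials, each multiplied by the value of the
product of the classes of these facets on the fundamental class
(`CharacteristicPair.toPoly_volumeCode`), so it is to be shown that these can be computed. The value
of a monomial without repeated factors is known. In any other monomial, either the facets do not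
meet and it vanishes, or they have a vertex in common, since a nonempty face of a polytope has a
vertex; then unimodularity at this vertex expresses a repeated factor by the classes of facets that
do not contain the vertex (`CharacteristicPair.cls_eq_sum`). This increases the number of different
factors, and after `n` steps no repetitions are left (`CharacteristicPair.intersectionNumber_spec`).

All procedures are written as primitive recursive functions on lists.
-/

namespace VolumePolynomial

/-! ### Primitive recursive functions on integers, signs and lists -/

-- With the composition rules below, `fun_prop` proves that a function given by an explicit
-- expression is primitive recursive.
attribute [fun_prop] Primrec

instance : Primcodable SignType := Primcodable.ofEquiv (Fin 3) SignType.fin3Equiv.toEquiv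

namespace PrimrecRules

variable {α β γ σ : Type*} [Primcodable α] [Primcodable β] [Primcodable γ] [Primcodable σ]

@[fun_prop]
theorem id_rule : Primrec (fun x : α => x) := Primrec.id

@[fun_prop]
theorem const_rule (y : β) : Primrec (fun _ : α => y) := Primrec.const y

@[fun_prop]
theorem comp_rule (f : β → γ) (g : α → β) (hf : Primrec f) (hg : Primrec g) :
    Primrec (fun x => f (g x)) := hf.comp hg

@[fun_prop]
theorem fst_rule (f : α → β × γ) (hf : Primrec f) : Primrec (fun x => (f x).1) :=
  Primrec.fst.comp hf

@[fun_prop]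
theorem snd_rule (f : α → β × γ) (hf : Primrec f) : Primrec (fun x => (f x).2) :=
  Primrec.snd.comp hf

@[fun_prop]
theorem pair_rule (f : α → β) (g : α → γ) (hf : Primrec f) (hg : Primrec g) :
    Primrec (fun x => Prod.mk (f x) (g x)) := hf.pair hg

@[fun_prop]
theorem nat_add_rule (f g : α → ℕ) (hf : Primrec f) (hg : Primrec g) :
    Primrec (fun x => f x + g x) := Primrec.nat_add.comp hf hg

@[fun_prop]
theorem nat_sub_rule (f g : α → ℕ) (hf : Primrec f) (hg : Primrec g) :
    Primrec (fun x => f x - g x) := Primrec.nat_sub.comp hf hg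

@[fun_prop]
theorem nat_mul_rule (f g : α → ℕ) (hf : Primrec f) (hg : Primrec g) :
    Primrec (fun x => f x * g x) := Primrec.nat_mul.comp hf hg

@[fun_prop]
theorem eq_rule [DecidableEq β] (f g : α → β) (hf : Primrec f) (hg : Primrec g) :
    Primrec (fun x => decide (f x = g x)) :=
  (Primrec.eq.comp hf hg).decide

@[fun_prop]
theorem nat_le_rule (f g : α → ℕ) (hf : Primrec f) (hg : Primrec g) :
    Primrec (fun x => decide (f x ≤ g x)) :=
  (Primrec.nat_le.comp hf hg).decide

@[fun_prop]
theorem nat_lt_rule (f g : α → ℕ) (hf : Primrec f) (hg : Primrec g) :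
    Primrec (fun x => decide (f x < g x)) :=
  (Primrec.nat_lt.comp hf hg).decide

@[fun_prop]
theorem not_rule (p : α → Prop) [DecidablePred p] (hp : Primrec (fun x => decide (p x))) :
    Primrec (fun x => decide (¬ p x)) :=
  ((primrecPred_iff_primrec_decide.2 hp).not).decide

@[fun_prop]
theorem and_rule (p q : α → Prop) [DecidablePred p] [DecidablePred q]
    (hp : Primrec (fun x => decide (p x))) (hq : Primrec (fun x => decide (q x))) :
    Primrec (fun x => decide (p x ∧ q x)) :=
  ((primrecPred_iff_primrec_decide.2 hp).and (primrecPred_iff_primrec_decide.2 hq)).decide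

@[fun_prop]
theorem band_rule (f g : α → Bool) (hf : Primrec f) (hg : Primrec g) :
    Primrec (fun x => f x && g x) := Primrec.and.comp hf hg

@[fun_prop]
theorem bor_rule (f g : α → Bool) (hf : Primrec f) (hg : Primrec g) :
    Primrec (fun x => f x || g x) := Primrec.or.comp hf hg

@[fun_prop]
theorem bnot_rule (f : α → Bool) (hf : Primrec f) :
    Primrec (fun x => !f x) := Primrec.not.comp hf

@[fun_prop]
theorem ite_rule (c : α → Prop) [DecidablePred c] (f g : α → β)
    (hc : Primrec (fun x => decide (c x))) (hf : Primrec f) (hg : Primrec g) :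
    Primrec (fun x => if c x then f x else g x) :=
  Primrec.ite (primrecPred_iff_primrec_decide.2 hc) hf hg

@[fun_prop]
theorem some_rule (f : α → β) (hf : Primrec f) : Primrec (fun x => some (f x)) :=
  Primrec.option_some.comp hf

@[fun_prop]
theorem option_elim_rule (f : α → Option β) (g : α → γ) (h : α → β → γ) (hf : Primrec f)
    (hg : Primrec g) (hh : Primrec (fun p : α × β => h p.1 p.2)) :
    Primrec (fun x => (f x).elim (g x) (fun y => h x y)) :=
  (Primrec.option_casesOn hf hg hh).of_eq fun x => by cases f x <;> rfl

@[fun_prop]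
theorem cons_rule (f : α → β) (g : α → List β) (hf : Primrec f) (hg : Primrec g) :
    Primrec (fun x => f x :: g x) := Primrec.list_cons.comp hf hg

@[fun_prop]
theorem append_rule (f g : α → List β) (hf : Primrec f) (hg : Primrec g) :
    Primrec (fun x => f x ++ g x) := Primrec.list_append.comp hf hg

@[fun_prop]
theorem length_rule (f : α → List β) (hf : Primrec f) : Primrec (fun x => (f x).length) :=
  Primrec.list_length.comp hf

@[fun_prop]
theorem tail_rule (f : α → List β) (hf : Primrec f) : Primrec (fun x => (f x).tail) :=
  Primrec.list_tail.comp hf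

@[fun_prop]
theorem range_rule (f : α → ℕ) (hf : Primrec f) : Primrec (fun x => List.range (f x)) :=
  Primrec.list_range.comp hf

@[fun_prop]
theorem getD_rule (f : α → List β) (i : α → ℕ) (d : β) (hf : Primrec f) (hi : Primrec i) :
    Primrec (fun x => (f x).getD (i x) d) := (Primrec.list_getD d).comp hf hi

@[fun_prop]
theorem set_rule (f : α → List β) (i : α → ℕ) (g : α → β) (hf : Primrec f) (hi : Primrec i)
    (hg : Primrec g) : Primrec (fun x => (f x).set (i x) (g x)) :=
  Primrec.list_set.comp hf (hi.pair hg)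

@[fun_prop]
theorem idxOf_rule [BEq β] [LawfulBEq β] (f : α → List β) (g : α → β) (hf : Primrec f)
    (hg : Primrec g) : Primrec (fun x => (f x).idxOf (g x)) := by
  classical
  have h : Primrec (fun x => @List.idxOf β instBEqOfDecidableEq (g x) (f x)) :=
    Primrec.list_idxOf.comp hg hf
  refine h.of_eq fun x => ?_
  congr 1
  exact lawful_beq_subsingleton _ _

@[fun_prop]
theorem map_rule (f : α → List β) (g : α → β → γ) (hf : Primrec f)
    (hg : Primrec (fun p : α × β => g p.1 p.2)) :
    Primrec (fun x => (f x).map (fun y => g x y)) := Primrec.list_map hf hg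

@[fun_prop]
theorem flatMap_rule (f : α → List β) (g : α → β → List γ) (hf : Primrec f)
    (hg : Primrec (fun p : α × β => g p.1 p.2)) :
    Primrec (fun x => (f x).flatMap (fun y => g x y)) := Primrec.list_flatMap hf hg

@[fun_prop]
theorem foldr_rule (f : α → List β) (g : α → β → γ → γ) (z : α → γ) (hf : Primrec f)
    (hz : Primrec z) (hg : Primrec (fun p : α × β × γ => g p.1 p.2.1 p.2.2)) :
    Primrec (fun x => (f x).foldr (fun y s => g x y s) (z x)) :=
  Primrec.list_foldr (h := fun x p => g x p.1 p.2) hf hz hg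

@[fun_prop]
theorem iterate_rule (n : α → ℕ) (z : α → β) (g : α → β → β) (hn : Primrec n)
    (hz : Primrec z) (hg : Primrec (fun p : α × β => g p.1 p.2)) :
    Primrec (fun x => (fun y => g x y)^[n x] (z x)) :=
  Primrec.nat_iterate hn hz hg

@[fun_prop]
theorem filter_rule (f : α → List β) (p : α → β → Bool) (hf : Primrec f)
    (hp : Primrec (fun q : α × β => p q.1 q.2)) :
    Primrec (fun x => (f x).filter (fun y => p x y)) := by
  have h : Primrec (fun x => (f x).flatMap (fun y => if p x y = true then [y] else [])) := by
    fun_prop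
  refine h.of_eq fun x => ?_
  induction f x with
  | nil => rfl
  | cons a l ih =>
    by_cases ha : p x a <;> simp [ha, ih]

@[fun_prop]
theorem find_rule (f : α → List β) (p : α → β → Bool) (hf : Primrec f)
    (hp : Primrec (fun q : α × β => p q.1 q.2)) :
    Primrec (fun x => (f x).find? (fun y => p x y)) := by
  have h : Primrec (fun x => (f x).foldr (fun y s => if p x y = true then some y else s)
      (none : Option β)) := by
    fun_prop
  refine h.of_eq fun x => ?_
  induction f x with
  | nil => rfl
  | cons a l ih =>
    by_cases ha : p x a <;> simp [ha, ih]

@[fun_prop]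
theorem any_rule (f : α → List β) (p : α → β → Bool) (hf : Primrec f)
    (hp : Primrec (fun q : α × β => p q.1 q.2)) :
    Primrec (fun x => (f x).any (fun y => p x y)) := by
  have h : Primrec (fun x => (f x).foldr (fun y s => p x y || s) false) := by fun_prop
  refine h.of_eq fun x => ?_
  induction f x with
  | nil => rfl
  | cons a l ih => simp [ih]

@[fun_prop]
theorem all_rule (f : α → List β) (p : α → β → Bool) (hf : Primrec f)
    (hp : Primrec (fun q : α × β => p q.1 q.2)) :
    Primrec (fun x => (f x).all (fun y => p x y)) := by
  have h : Primrec (fun x => (f x).foldr (fun y s => p x y && s) true) := by fun_prop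
  refine h.of_eq fun x => ?_
  induction f x with
  | nil => rfl
  | cons a l ih => simp [ih]

@[fun_prop]
theorem mem_rule [DecidableEq β] (f : α → β) (g : α → List β) (hf : Primrec f)
    (hg : Primrec g) : Primrec (fun x => decide (f x ∈ g x)) := by
  have h : Primrec (fun x => (g x).any (fun y => decide (y = f x))) := by fun_prop
  refine h.of_eq fun x => ?_
  rw [Bool.eq_iff_iff]
  simp

@[fun_prop]
theorem count_rule [BEq β] [LawfulBEq β] (f : α → β) (g : α → List β) (hf : Primrec f)
    (hg : Primrec g) : Primrec (fun x => (g x).count (f x)) := by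
  classical
  have h : Primrec (fun x => ((g x).filter (fun y => decide (y = f x))).length) := by fun_prop
  refine h.of_eq fun x => ?_
  rw [List.count_eq_length_filter]
  congr 1
  refine List.filter_congr fun y _ => ?_
  rw [Bool.eq_iff_iff, beq_iff_eq, decide_eq_true_iff]

@[fun_prop]
theorem replicate_rule (n : α → ℕ) (f : α → β) (hn : Primrec n) (hf : Primrec f) :
    Primrec (fun x => List.replicate (n x) (f x)) := by
  have h : Primrec (fun x => (List.range (n x)).map (fun _ => f x)) := by fun_prop
  exact h.of_eq fun x => by simp

@[fun_prop]
theorem nat_sum_rule (f : α → List ℕ) (hf : Primrec f) : Primrec (fun x => (f x).sum) := by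
  have h : Primrec (fun x => (f x).foldr (fun y s => y + s) 0) := by fun_prop
  exact h

theorem natCast_int : Primrec (fun n : ℕ => (n : ℤ)) := by
  have h : Primrec (fun n : ℕ => Denumerable.ofNat ℤ (2 * n)) :=
    (Primrec.ofNat ℤ).comp (by fun_prop)
  refine h.of_eq fun n => ?_
  apply Encodable.encode_injective
  rw [Denumerable.encode_ofNat]
  rfl

theorem negSucc_int : Primrec (fun n : ℕ => Int.negSucc n) := by
  have h : Primrec (fun n : ℕ => Denumerable.ofNat ℤ (2 * n + 1)) :=
    (Primrec.ofNat ℤ).comp (by fun_prop)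
  refine h.of_eq fun n => ?_
  apply Encodable.encode_injective
  rw [Denumerable.encode_ofNat]
  rfl

@[fun_prop]
theorem natCast_rule (f : α → ℕ) (hf : Primrec f) : Primrec (fun x => (f x : ℤ)) :=
  natCast_int.comp hf

theorem toNat_int : Primrec Int.toNat := by
  have h : Primrec (fun z : ℤ => if Nat.bodd (Encodable.encode z) = true then 0
      else Nat.div2 (Encodable.encode z)) :=
    ite_rule _ _ _ (eq_rule _ _ (Primrec.nat_bodd.comp Primrec.encode) (const_rule _))
      (const_rule _) (Primrec.nat_div2.comp Primrec.encode)
  refine h.of_eq fun z => ?_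
  cases z with
  | ofNat n =>
    have : Encodable.encode (Int.ofNat n) = 2 * n := rfl
    rw [this]
    simp [Nat.div2_val]
  | negSucc n =>
    have : Encodable.encode (Int.negSucc n) = 2 * n + 1 := rfl
    rw [this]
    simp

@[fun_prop]
theorem toNat_rule (f : α → ℤ) (hf : Primrec f) : Primrec (fun x => (f x).toNat) :=
  toNat_int.comp hf

@[fun_prop]
theorem subNat_rule (f g : α → ℕ) (hf : Primrec f) (hg : Primrec g) :
    Primrec (fun x => (f x : ℤ) - (g x : ℤ)) := by
  have h : Primrec (fun x => if g x ≤ f x then ((f x - g x : ℕ) : ℤ)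
      else Int.negSucc (g x - f x - 1)) :=
    ite_rule _ _ _ (by fun_prop) (by fun_prop) (negSucc_int.comp (by fun_prop))
  refine h.of_eq fun x => ?_
  split_ifs with hx <;> omega

@[fun_prop]
theorem int_neg_rule (f : α → ℤ) (hf : Primrec f) : Primrec (fun x => -f x) := by
  have h : Primrec (fun z : ℤ => if Nat.bodd (Encodable.encode z) = true then
      ((Nat.div2 (Encodable.encode z) + 1 : ℕ) : ℤ) else
      ((0 : ℕ) : ℤ) - ((Nat.div2 (Encodable.encode z) : ℕ) : ℤ)) :=
    ite_rule _ _ _ (eq_rule _ _ (Primrec.nat_bodd.comp Primrec.encode) (const_rule _))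
      (natCast_rule _ (nat_add_rule _ _ (Primrec.nat_div2.comp Primrec.encode) (const_rule _)))
      (subNat_rule _ _ (const_rule _) (Primrec.nat_div2.comp Primrec.encode))
  have h' : Primrec (fun z : ℤ => -z) := by
    refine h.of_eq fun z => ?_
    cases z with
    | ofNat n =>
      have : Encodable.encode (Int.ofNat n) = 2 * n := rfl
      rw [this]
      simp [Nat.div2_val]
    | negSucc n =>
      have : Encodable.encode (Int.negSucc n) = 2 * n + 1 := rfl
      rw [this]
      simp [Nat.div2_val]
  exact h'.comp hf

@[fun_prop]
theorem int_add_rule (f g : α → ℤ) (hf : Primrec f) (hg : Primrec g) :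
    Primrec (fun x => f x + g x) := by
  have h : Primrec (fun x => (((f x).toNat + (g x).toNat : ℕ) : ℤ) -
      (((-f x).toNat + (-g x).toNat : ℕ) : ℤ)) := by fun_prop
  exact h.of_eq fun x => by omega

@[fun_prop]
theorem int_sub_rule (f g : α → ℤ) (hf : Primrec f) (hg : Primrec g) :
    Primrec (fun x => f x - g x) := by
  have h : Primrec (fun x => f x + -g x) := by fun_prop
  exact h

@[fun_prop]
theorem int_mul_rule (f g : α → ℤ) (hf : Primrec f) (hg : Primrec g) :
    Primrec (fun x => f x * g x) := by
  have h : Primrec (fun x =>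
      (((f x).toNat * (g x).toNat + (-f x).toNat * (-g x).toNat : ℕ) : ℤ) -
      (((f x).toNat * (-g x).toNat + (-f x).toNat * (g x).toNat : ℕ) : ℤ)) := by fun_prop
  refine h.of_eq fun x => ?_
  have h1 : f x = ((f x).toNat : ℤ) - ((-f x).toNat : ℤ) := by omega
  have h2 : g x = ((g x).toNat : ℤ) - ((-g x).toNat : ℤ) := by omega
  conv_rhs => rw [h1, h2]
  push_cast
  ring

@[fun_prop]
theorem int_sign_rule (f : α → ℤ) (hf : Primrec f) : Primrec (fun x => (f x).sign) := by
  have h : Primrec (fun x => if 0 < (f x).toNat then (1 : ℤ) else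
      if 0 < (-f x).toNat then -1 else 0) := by fun_prop
  refine h.of_eq fun x => ?_
  rcases lt_trichotomy (f x) 0 with h | h | h
  · rw [Int.sign_eq_neg_one_of_neg h, if_neg (by omega), if_pos (by omega)]
  · simp [h]
  · rw [Int.sign_eq_one_of_pos h, if_pos (by omega)]

@[fun_prop]
theorem int_pos_rule (f : α → ℤ) (hf : Primrec f) : Primrec (fun x => decide (0 < f x)) := by
  have h : Primrec (fun x => decide (0 < (f x).toNat)) := by fun_prop
  refine h.of_eq fun x => ?_
  rw [decide_eq_decide]
  omega

@[fun_prop]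
theorem int_sum_rule (f : α → List ℤ) (hf : Primrec f) : Primrec (fun x => (f x).sum) := by
  have h : Primrec (fun x => (f x).foldr (fun y s => y + s) 0) := by fun_prop
  exact h

@[fun_prop]
theorem int_prod_rule (f : α → List ℤ) (hf : Primrec f) : Primrec (fun x => (f x).prod) := by
  have h : Primrec (fun x => (f x).foldr (fun y s => y * s) 1) := by fun_prop
  exact h

@[fun_prop]
theorem nat_prod_rule (f : α → List ℕ) (hf : Primrec f) : Primrec (fun x => (f x).prod) := by
  have h : Primrec (fun x => (f x).foldr (fun y s => y * s) 1) := by fun_prop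
  exact h

@[fun_prop]
theorem sign_mul_rule (f g : α → SignType) (hf : Primrec f) (hg : Primrec g) :
    Primrec (fun x => f x * g x) :=
  (Primrec.dom_finite (fun p : SignType × SignType => p.1 * p.2)).comp (hf.pair hg)

@[fun_prop]
theorem sign_pow_rule (f : α → SignType) (n : α → ℕ) (hf : Primrec f) (hn : Primrec n) :
    Primrec (fun x => f x ^ n x) := by
  have h : Primrec (fun x => (fun s => s * f x)^[n x] 1) := by fun_prop
  exact h.of_eq fun x => by rw [mul_right_iterate]; simp

end PrimrecRules

end VolumePolynomial

namespace VolumePolynomial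

open Polynomial Filter Topology

/-! ### Polynomial expressions in finitely many indeterminates -/

namespace CoeffPoly

/-- The value of a polynomial expression when the indeterminate named `l` has the value `ρ l`. -/
def ev (ρ : List ℕ → ℝ) (p : CoeffPoly) : ℝ :=
  (p.map fun t => (t.1 : ℝ) * (t.2.map ρ).prod).sum

/-- Product. -/
def mul (p q : CoeffPoly) : CoeffPoly :=
  p.flatMap fun s => q.map fun t => (s.1 * t.1, s.2 ++ t.2)

/-- Product with an integer. -/
def smul (z : ℤ) (p : CoeffPoly) : CoeffPoly :=
  p.map fun t => (z * t.1, t.2)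

variable (ρ : List ℕ → ℝ)

@[simp] theorem ev_nil : ev ρ [] = 0 := by simp [ev]

@[simp] theorem ev_cons (t : ℤ × List (List ℕ)) (p : CoeffPoly) :
    ev ρ (t :: p) = (t.1 : ℝ) * (t.2.map ρ).prod + ev ρ p := by simp [ev]

@[simp] theorem ev_append (p q : CoeffPoly) : ev ρ (p ++ q) = ev ρ p + ev ρ q := by
  simp [ev]

@[simp] theorem ev_smul (z : ℤ) (p : CoeffPoly) : ev ρ (smul z p) = z * ev ρ p := by
  induction p with
  | nil => simp [smul]
  | cons t p ih =>
    have : smul z (t :: p) = (z * t.1, t.2) :: smul z p := rfl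
    rw [this, ev_cons, ih, ev_cons]
    push_cast
    ring

@[simp] theorem ev_mul (p q : CoeffPoly) : ev ρ (mul p q) = ev ρ p * ev ρ q := by
  induction p with
  | nil => simp [mul]
  | cons s p ih =>
    have h : mul (s :: p) q = (q.map fun t => (s.1 * t.1, s.2 ++ t.2)) ++ mul p q := by
      simp [mul]
    have h2 : ev ρ (q.map fun t => (s.1 * t.1, s.2 ++ t.2)) =
        (s.1 : ℝ) * (s.2.map ρ).prod * ev ρ q := by
      clear h ih
      induction q with
      | nil => simp
      | cons t q ih =>
        simp only [List.map_cons, ev_cons, ih]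
        simp only [Int.cast_mul, List.map_append, List.prod_append]
        ring
    rw [h, ev_append, ih, h2, ev_cons]
    ring

variable {α : Type*} [Primcodable α]

@[fun_prop]
theorem mul_primrec (f g : α → CoeffPoly) (hf : Primrec f) (hg : Primrec g) :
    Primrec (fun x => mul (f x) (g x)) := by
  unfold mul; fun_prop

@[fun_prop]
theorem smul_primrec (z : α → ℤ) (f : α → CoeffPoly) (hz : Primrec z) (hf : Primrec f) :
    Primrec (fun x => smul (z x) (f x)) := by
  unfold smul; fun_prop

end CoeffPoly

open CoeffPoly

/-! ### Univariate polynomials with parameters -/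

/-- A univariate polynomial whose coefficients are polynomial expressions, as the list of its
coefficients, beginning with that of the highest power. The first coefficient may vanish. -/
abbrev UPoly : Type := List CoeffPoly

namespace UPoly

/-- The formal leading coefficient. -/
def head (u : UPoly) : CoeffPoly := u.getD 0 []

/-- The derivative. -/
def deriv (u : UPoly) : UPoly :=
  (List.range (u.length - 1)).map fun i => smul ((u.length - 1 - i : ℕ) : ℤ) (u.getD i [])

/-- The polynomial `b² p - a b xᵏ q`, where `a` and `b` are the formal leading coefficients of `p`
and `q`, and `k` is such that the terms of highest degree cancel. The even power of `b` keeps the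
sign of `p` at the roots of `q`. -/
def reduce (p q : UPoly) : UPoly :=
  (List.range (p.length - 1)).map fun i =>
    mul (mul (head q) (head q)) (p.getD (i + 1) []) ++
      smul (-1) (mul (mul (head p) (head q)) (q.getD (i + 1) []))

/-- The pseudo-remainder of `p` by `q`. -/
def prem (p q : UPoly) : UPoly := (fun r => reduce r q)^[p.length + 1 - q.length] p

/-- The coefficient at `vʲ` of a polynomial expression. -/
def coeffAt (v : List ℕ) (j : ℕ) (p : CoeffPoly) : CoeffPoly :=
  (p.filter fun t => decide (t.2.count v = j)).map fun t =>
    (t.1, t.2.filter fun w => decide (¬ w = v))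

/-- A polynomial expression as a univariate polynomial in the indeterminate `v`. -/
def ofCoeffPoly (v : List ℕ) (p : CoeffPoly) : UPoly :=
  (List.range ((p.map fun t => t.2.length).sum + 1)).map fun i =>
    coeffAt v ((p.map fun t => t.2.length).sum - i) p

section Primrec

variable {α : Type*} [Primcodable α]

@[fun_prop]
theorem head_primrec (f : α → UPoly) (hf : Primrec f) : Primrec (fun x => head (f x)) := by
  unfold head; fun_prop

@[fun_prop]
theorem deriv_primrec (f : α → UPoly) (hf : Primrec f) : Primrec (fun x => deriv (f x)) := by
  unfold deriv; fun_prop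

@[fun_prop]
theorem reduce_primrec (f g : α → UPoly) (hf : Primrec f) (hg : Primrec g) :
    Primrec (fun x => reduce (f x) (g x)) := by
  unfold reduce; fun_prop

@[fun_prop]
theorem prem_primrec (f g : α → UPoly) (hf : Primrec f) (hg : Primrec g) :
    Primrec (fun x => prem (f x) (g x)) := by
  unfold prem; fun_prop

@[fun_prop]
theorem coeffAt_primrec (v : α → List ℕ) (j : α → ℕ) (p : α → CoeffPoly) (hv : Primrec v)
    (hj : Primrec j) (hp : Primrec p) : Primrec (fun x => coeffAt (v x) (j x) (p x)) := by
  unfold coeffAt; fun_prop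

@[fun_prop]
theorem ofCoeffPoly_primrec (v : α → List ℕ) (p : α → CoeffPoly) (hv : Primrec v)
    (hp : Primrec p) : Primrec (fun x => ofCoeffPoly (v x) (p x)) := by
  unfold ofCoeffPoly; fun_prop

end Primrec

variable (ρ : List ℕ → ℝ)

/-- The real polynomial obtained from values of the parameters. -/
noncomputable def toPoly (ρ : List ℕ → ℝ) : UPoly → ℝ[X]
  | [] => 0
  | a :: u => C (ev ρ a) * X ^ u.length + toPoly ρ u

@[simp] theorem toPoly_nil : toPoly ρ [] = 0 := rfl

theorem toPoly_cons (a : CoeffPoly) (u : UPoly) :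
    toPoly ρ (a :: u) = C (ev ρ a) * X ^ u.length + toPoly ρ u := rfl

theorem toPoly_map_range (n : ℕ) (f : ℕ → CoeffPoly) :
    toPoly ρ ((List.range n).map f) =
      ∑ i ∈ Finset.range n, C (ev ρ (f i)) * X ^ (n - 1 - i) := by
  induction n generalizing f with
  | zero => simp
  | succ n ih =>
    rw [List.range_succ_eq_map, List.map_cons, List.map_map, toPoly_cons, ih,
      Finset.sum_range_succ']
    simp only [List.length_map, List.length_range, Function.comp_apply]
    rw [add_comm]
    congr 1
    refine Finset.sum_congr rfl fun i _ => ?_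
    congr 2
    omega

theorem eq_map_range_getD {β : Type*} (u : List β) (d : β) :
    u = (List.range u.length).map fun i => u.getD i d := by
  apply List.ext_getElem
  · simp
  · intro i h1 h2
    simp [h1]

theorem toPoly_eq_sum (u : UPoly) :
    toPoly ρ u = ∑ i ∈ Finset.range u.length, C (ev ρ (u.getD i [])) * X ^ (u.length - 1 - i) := by
  conv_lhs => rw [eq_map_range_getD u []]
  rw [toPoly_map_range]

theorem length_deriv (u : UPoly) : (deriv u).length = u.length - 1 := by simp [deriv]

theorem length_reduce (p q : UPoly) : (reduce p q).length = p.length - 1 := by simp [reduce]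

theorem toPoly_deriv (u : UPoly) : toPoly ρ (deriv u) = derivative (toPoly ρ u) := by
  rw [deriv, toPoly_map_range, toPoly_eq_sum ρ u, derivative_sum]
  simp only [derivative_C_mul_X_pow]
  rcases hn : u.length with _ | n
  · simp
  · rw [Finset.sum_range_succ]
    simp only [Nat.add_sub_cancel, Nat.sub_self, Nat.cast_zero, mul_zero, map_zero, zero_mul,
      add_zero, ev_smul]
    refine Finset.sum_congr rfl fun i hi => ?_
    have : n - 1 - i = n - i - 1 := by omega
    rw [this]
    simp
    ring

theorem toPoly_reduce (p q : UPoly) (h1 : 1 ≤ q.length) (h2 : q.length ≤ p.length) :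
    toPoly ρ (reduce p q) = C (ev ρ (head q) ^ 2) * toPoly ρ p -
      C (ev ρ (head p) * ev ρ (head q)) * X ^ (p.length - q.length) * toPoly ρ q := by
  have hq : X ^ (p.length - q.length) * toPoly ρ q =
      ∑ i ∈ Finset.range p.length, C (ev ρ (q.getD i [])) * X ^ (p.length - 1 - i) := by
    rw [toPoly_eq_sum ρ q, Finset.mul_sum]
    rw [← Finset.sum_subset (Finset.range_mono h2)]
    · refine Finset.sum_congr rfl fun i hi => ?_
      have : p.length - 1 - i = (p.length - q.length) + (q.length - 1 - i) := by
        have := Finset.mem_range.1 hi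
        omega
      rw [this, pow_add]
      ring
    · intro i _ hi
      have : q.getD i [] = [] := by
        rw [List.getD_eq_default]
        simpa using hi
      rw [this]
      simp
  rw [mul_assoc, hq, toPoly_eq_sum ρ p, reduce, toPoly_map_range, Finset.mul_sum, Finset.mul_sum,
    ← Finset.sum_sub_distrib]
  obtain ⟨n, hn⟩ : ∃ n, p.length = n + 1 := ⟨p.length - 1, by omega⟩
  rw [hn, Finset.sum_range_succ']
  have h0 : C (ev ρ (head q) ^ 2) * (C (ev ρ (p.getD 0 [])) * X ^ (n + 1 - 1 - 0)) -
      C (ev ρ (head p) * ev ρ (head q)) * (C (ev ρ (q.getD 0 [])) * X ^ (n + 1 - 1 - 0)) = 0 := by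
    change C (ev ρ (head q) ^ 2) * (C (ev ρ (head p)) * X ^ (n + 1 - 1 - 0)) -
      C (ev ρ (head p) * ev ρ (head q)) * (C (ev ρ (head q)) * X ^ (n + 1 - 1 - 0)) = 0
    rw [← mul_assoc, ← mul_assoc, ← C_mul, ← C_mul]
    ring_nf
  rw [h0, add_zero, Nat.add_sub_cancel]
  refine Finset.sum_congr rfl fun i hi => ?_
  have : n - 1 - i = n - (i + 1) := by omega
  rw [this, ← mul_assoc, ← mul_assoc, ← C_mul, ← C_mul, ← sub_mul, ← C_sub]
  congr 2
  simp
  ring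

theorem sign_eval_reduce (p q : UPoly) (h2 : q.length ≤ p.length)
    (hb : ev ρ (head q) ≠ 0) {x : ℝ} (hx : (toPoly ρ q).eval x = 0) :
    SignType.sign ((toPoly ρ (reduce p q)).eval x) = SignType.sign ((toPoly ρ p).eval x) := by
  have h1 : 1 ≤ q.length := by
    rcases q with _ | ⟨a, q⟩
    · simp [head] at hb
    · simp
  rw [toPoly_reduce ρ p q h1 h2]
  simp only [eval_sub, eval_mul, eval_C, hx, mul_zero, sub_zero, sign_mul]
  rw [sign_pos (by positivity), one_mul]

theorem length_iterate_reduce (p q : UPoly) (k : ℕ) :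
    ((fun r => reduce r q)^[k] p).length = p.length - k := by
  induction k with
  | zero => simp
  | succ k ih =>
    rw [Function.iterate_succ_apply', length_reduce, ih]
    omega

theorem length_prem (p q : UPoly) (h : q.length ≤ p.length) (h1 : 1 ≤ q.length) :
    (prem p q).length = q.length - 1 := by
  rw [prem, length_iterate_reduce]
  omega

/-- At a root of `q`, the pseudo-remainder of `p` by `q` has the sign of `p`. -/
theorem sign_eval_prem (p q : UPoly)
    (hb : ev ρ (head q) ≠ 0) {x : ℝ} (hx : (toPoly ρ q).eval x = 0) :
    SignType.sign ((toPoly ρ (prem p q)).eval x) = SignType.sign ((toPoly ρ p).eval x) := by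
  rw [prem]
  have : ∀ k ≤ p.length + 1 - q.length,
      SignType.sign ((toPoly ρ ((fun r => reduce r q)^[k] p)).eval x) =
        SignType.sign ((toPoly ρ p).eval x) := by
    intro k hk
    induction k with
    | zero => rfl
    | succ k ih =>
      rw [Function.iterate_succ_apply', sign_eval_reduce ρ _ q _ hb hx, ih (by omega)]
      rw [length_iterate_reduce]
      omega
  exact this _ le_rfl

theorem degree_toPoly_lt (u : UPoly) : (toPoly ρ u).degree < u.length := by
  induction u with
  | nil => simp
  | cons a u ih =>
    rw [toPoly_cons]
    refine (degree_add_le _ _).trans_lt (max_lt ?_ ?_)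
    · refine (degree_C_mul_X_pow_le _ _).trans_lt ?_
      exact_mod_cast Nat.lt_succ_self _
    · refine ih.trans ?_
      exact_mod_cast Nat.lt_succ_self _

/-- If the formal leading coefficient does not vanish, it is the leading coefficient. -/
theorem natDegree_leadingCoeff (u : UPoly) (h : ev ρ (head u) ≠ 0) :
    (toPoly ρ u).natDegree = u.length - 1 ∧ (toPoly ρ u).leadingCoeff = ev ρ (head u) := by
  rcases u with _ | ⟨a, u⟩
  · simp [head] at h
  · have ha : ev ρ a ≠ 0 := h
    have hd : (toPoly ρ u).degree < (C (ev ρ a) * X ^ u.length).degree := by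
      rw [degree_C_mul_X_pow _ ha]
      exact degree_toPoly_lt ρ u
    rw [toPoly_cons]
    constructor
    · rw [natDegree_add_eq_left_of_degree_lt hd, natDegree_C_mul_X_pow _ _ ha]
      simp
    · rw [leadingCoeff_add_of_degree_lt' hd, leadingCoeff_C_mul_X_pow]
      rfl

theorem prod_map_update (v : List ℕ) (x : ℝ) (l : List (List ℕ)) :
    (l.map (Function.update ρ v x)).prod =
      ((l.filter fun w => decide (¬ w = v)).map ρ).prod * x ^ l.count v := by
  induction l with
  | nil => simp
  | cons w l ih =>
    by_cases h : w = v
    · subst h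
      simp [ih]
      ring
    · simp [ih, h]
      ring

theorem sum_coeffAt (v : List ℕ) (x : ℝ) (p : CoeffPoly) (N : ℕ)
    (hN : ∀ t ∈ p, t.2.count v ≤ N) :
    ∑ j ∈ Finset.range (N + 1), ev ρ (coeffAt v j p) * x ^ j =
      ev (Function.update ρ v x) p := by
  induction p with
  | nil => simp [coeffAt]
  | cons t p ih =>
    have h : ∀ j, ev ρ (coeffAt v j (t :: p)) =
        (if t.2.count v = j then
          (t.1 : ℝ) * ((t.2.filter fun w => decide (¬ w = v)).map ρ).prod else 0) +
          ev ρ (coeffAt v j p) := by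
      intro j
      by_cases hj : t.2.count v = j <;> simp [coeffAt, hj]
    simp only [h, add_mul, Finset.sum_add_distrib]
    rw [ih fun s hs => hN s (List.mem_cons_of_mem _ hs), ev_cons, prod_map_update]
    congr 1
    simp only [ite_mul, zero_mul]
    rw [Finset.sum_ite_eq, if_pos]
    · ring
    · have := hN t List.mem_cons_self
      exact Finset.mem_range.2 (by omega)

theorem eval_ofCoeffPoly (v : List ℕ) (p : CoeffPoly) (x : ℝ) :
    (toPoly ρ (ofCoeffPoly v p)).eval x = ev (Function.update ρ v x) p := by
  rw [ofCoeffPoly, toPoly_map_range, ← sum_coeffAt ρ v x p (p.map fun t => t.2.length).sum,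
    eval_finsetSum, ← Finset.sum_range_reflect]
  · refine Finset.sum_congr rfl fun j hj => ?_
    have h1 : (p.map fun t => t.2.length).sum + 1 - 1 - j ≤ (p.map fun t => t.2.length).sum := by
      omega
    simp only [eval_mul, eval_C, eval_pow, eval_X]
    have := Finset.mem_range.1 hj
    have h2 : (p.map fun t => t.2.length).sum -
        ((p.map fun t => t.2.length).sum + 1 - 1 - j) = j := by omega
    have h3 : (p.map fun t => t.2.length).sum + 1 - 1 -
        ((p.map fun t => t.2.length).sum + 1 - 1 - j) = j := by omega
    rw [h2, h3]
  · intro t ht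
    refine List.count_le_length.trans ?_
    exact List.single_le_sum (by simp) _ (List.mem_map.2 ⟨t, ht, rfl⟩)

end UPoly

end VolumePolynomial

namespace VolumePolynomial

open Polynomial Filter Topology CoeffPoly

/-! ### Families of univariate polynomials closed under derivatives and pseudo-remainders -/

namespace UPoly

/-- One step of the closure: the tails and derivatives of the members of formal degree `L - 1`, and
the pseudo-remainders by them, are added. -/
def closeLevel (L : ℕ) (S : List UPoly) : List UPoly :=
  S ++ ((S.filter fun u => decide (u.length = L)).map fun u => u.tail) ++
    ((S.filter fun u => decide (u.length = L)).map fun u => deriv u) ++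
    S.flatMap fun p => (S.filter fun q => decide (q.length = L ∧ q.length ≤ p.length)).map
      fun q => prem p q

/-- The closure of a family of polynomials of length at most `N` under tails, derivatives and
pseudo-remainders. -/
def closure (N : ℕ) (S : List UPoly) : List UPoly :=
  (List.range N).foldr (fun i S => closeLevel (i + 1) S) S

/-- The members of length at most `N`, in the order of decreasing length. -/
def sortLength (N : ℕ) (S : List UPoly) : List UPoly :=
  (List.range (N + 1)).flatMap fun i => S.filter fun u => decide (u.length = N - i)

/-- The closure of a family, in the order of decreasing length. -/
def closedFamily (S : List UPoly) : List UPoly :=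
  sortLength (S.map fun u => u.length).sum (closure (S.map fun u => u.length).sum S)

section Primrec

variable {α : Type*} [Primcodable α]

@[fun_prop]
theorem closeLevel_primrec (L : α → ℕ) (S : α → List UPoly) (hL : Primrec L) (hS : Primrec S) :
    Primrec (fun x => closeLevel (L x) (S x)) := by
  unfold closeLevel; fun_prop

@[fun_prop]
theorem closure_primrec (L : α → ℕ) (S : α → List UPoly) (hL : Primrec L) (hS : Primrec S) :
    Primrec (fun x => closure (L x) (S x)) := by
  unfold closure; fun_prop

@[fun_prop]
theorem sortLength_primrec (L : α → ℕ) (S : α → List UPoly) (hL : Primrec L) (hS : Primrec S) :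
    Primrec (fun x => sortLength (L x) (S x)) := by
  unfold sortLength; fun_prop

@[fun_prop]
theorem closedFamily_primrec (S : α → List UPoly) (hS : Primrec S) :
    Primrec (fun x => closedFamily (S x)) := by
  unfold closedFamily; fun_prop

end Primrec

/-- The family `S` contains the tail and the derivative of `u`, and the pseudo-remainders by `u` of
its members that are not shorter. -/
def ClosedAt (S : List UPoly) (u : UPoly) : Prop :=
  u.tail ∈ S ∧ deriv u ∈ S ∧ ∀ p ∈ S, u.length ≤ p.length → prem p u ∈ S

theorem mem_closeLevel {L : ℕ} {S : List UPoly} {u : UPoly} :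
    u ∈ closeLevel L S ↔ u ∈ S ∨ (∃ v ∈ S, v.length = L ∧ v.tail = u) ∨
      (∃ v ∈ S, v.length = L ∧ deriv v = u) ∨
      ∃ p ∈ S, ∃ v ∈ S, (v.length = L ∧ v.length ≤ p.length) ∧ prem p v = u := by
  simp only [closeLevel, List.mem_append, List.mem_map, List.mem_filter, List.mem_flatMap,
    decide_eq_true_eq, and_assoc, or_assoc]

theorem mem_of_mem_closeLevel {N : ℕ} {S : List UPoly} {u : UPoly}
    (hu : u ∈ closeLevel (N + 1) S) (h : N < u.length) : u ∈ S := by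
  rcases mem_closeLevel.1 hu with hu | ⟨v, _, hv, rfl⟩ | ⟨v, _, hv, rfl⟩ |
    ⟨p, _, v, _, ⟨hv, hvp⟩, rfl⟩
  · exact hu
  · simp [hv] at h
  · simp [length_deriv, hv] at h
  · rw [length_prem p v hvp (by omega)] at h
    omega

theorem closure_succ (N : ℕ) (S : List UPoly) :
    closure (N + 1) S = closure N (closeLevel (N + 1) S) := by
  simp [closure, List.range_succ]

/-- The lengths are treated in decreasing order. A step at length `N + 1` adds only polynomials of
length at most `N`, so that it does not impair what has been reached for greater lengths. -/
theorem closedAt_closure (N : ℕ) (S : List UPoly)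
    (h : ∀ u ∈ S, N < u.length → ClosedAt S u) :
    ∀ u ∈ closure N S, 0 < u.length → ClosedAt (closure N S) u := by
  induction N generalizing S with
  | zero => exact h
  | succ N ih =>
    rw [closure_succ]
    refine ih _ fun u hu hN => ?_
    have huS := mem_of_mem_closeLevel hu hN
    rcases (show N + 1 ≤ u.length from hN).eq_or_lt with hN1 | hN1
    · refine ⟨mem_closeLevel.2 (Or.inr (Or.inl ⟨u, huS, hN1.symm, rfl⟩)),
        mem_closeLevel.2 (Or.inr (Or.inr (Or.inl ⟨u, huS, hN1.symm, rfl⟩))), fun p hp hup => ?_⟩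
      have hpS := mem_of_mem_closeLevel hp (hN.trans_le hup)
      exact mem_closeLevel.2 (Or.inr (Or.inr (Or.inr ⟨p, hpS, u, huS, ⟨hN1.symm, hup⟩, rfl⟩)))
    · obtain ⟨h1, h2, h3⟩ := h u huS hN1
      refine ⟨mem_closeLevel.2 (Or.inl h1), mem_closeLevel.2 (Or.inl h2), fun p hp hup => ?_⟩
      have hpS := mem_of_mem_closeLevel hp (hN.trans_le hup)
      exact mem_closeLevel.2 (Or.inl (h3 p hpS hup))

theorem subset_closure (N : ℕ) (S : List UPoly) : ∀ u ∈ S, u ∈ closure N S := by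
  induction N generalizing S with
  | zero => exact fun u hu => hu
  | succ N ih =>
    rw [closure_succ]
    exact fun u hu => ih _ u (mem_closeLevel.2 (Or.inl hu))

theorem length_le_of_mem_closure (N : ℕ) (S : List UPoly) (M : ℕ) (hM : N ≤ M)
    (h : ∀ u ∈ S, u.length ≤ M) :
    ∀ u ∈ closure N S, u.length ≤ M := by
  induction N generalizing S with
  | zero => exact h
  | succ N ih =>
    rw [closure_succ]
    refine ih _ (by omega) fun u hu => ?_
    by_cases hN : N < u.length
    · exact h u (mem_of_mem_closeLevel hu hN)
    · omega

theorem mem_sortLength {N : ℕ} {S : List UPoly} {u : UPoly} :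
    u ∈ sortLength N S ↔ u ∈ S ∧ u.length ≤ N := by
  simp only [sortLength, List.mem_flatMap, List.mem_range, List.mem_filter, decide_eq_true_eq]
  constructor
  · rintro ⟨i, hi, hu, h⟩
    exact ⟨hu, by omega⟩
  · rintro ⟨hu, h⟩
    exact ⟨N - u.length, by omega, hu, by omega⟩

theorem pairwise_sortLength (N : ℕ) (S : List UPoly) :
    (sortLength N S).Pairwise fun p q => q.length ≤ p.length := by
  rw [sortLength, List.pairwise_flatMap]
  constructor
  · intro i _
    refine List.Pairwise.imp_of_mem (R := fun _ _ => True) ?_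
      (List.pairwise_of_forall fun _ _ => trivial)
    intro p q hp hq _
    simp only [List.mem_filter, decide_eq_true_eq] at hp hq
    omega
  · refine List.Pairwise.imp ?_ List.pairwise_lt_range
    intro i j hij p hp q hq
    simp only [List.mem_filter, decide_eq_true_eq] at hp hq
    omega

theorem mem_closedFamily_of_mem {S : List UPoly} {u : UPoly} (hu : u ∈ S) :
    u ∈ closedFamily S := by
  refine mem_sortLength.2 ⟨subset_closure _ _ u hu, ?_⟩
  exact List.single_le_sum (by simp) _ (List.mem_map.2 ⟨u, hu, rfl⟩)

/-- A list of polynomials in which the tail and the derivative of each member, and its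
pseudo-remainders by later members, are later members or empty. -/
inductive IsClosedChain : List UPoly → Prop
  | nil : IsClosedChain []
  | cons (u : UPoly) (S : List UPoly) : IsClosedChain S →
      (u.tail ∈ S ∨ u.tail = []) → (deriv u ∈ S ∨ deriv u = []) →
      (∀ v ∈ S, v ≠ [] → prem u v ∈ S ∨ prem u v = []) → IsClosedChain (u :: S)

theorem isClosedChain_closedFamily (S : List UPoly) : IsClosedChain (closedFamily S) := by
  have hlen : ∀ u ∈ S, u.length ≤ (S.map fun u => u.length).sum := fun u hu =>
    List.single_le_sum (by simp) _ (List.mem_map.2 ⟨u, hu, rfl⟩)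
  have hcl : ∀ u ∈ closedFamily S, 0 < u.length → ClosedAt (closedFamily S) u := by
    intro u hu h0
    obtain ⟨h1, h2, h3⟩ := closedAt_closure (S.map fun u => u.length).sum S
      (fun u hu h => absurd (hlen u hu) (by omega)) u (mem_sortLength.1 hu).1 h0
    have hmem : ∀ v ∈ closure (S.map fun u => u.length).sum S, v ∈ closedFamily S :=
      fun v hv => mem_sortLength.2 ⟨hv, length_le_of_mem_closure _ S _ le_rfl hlen v hv⟩
    exact ⟨hmem _ h1, hmem _ h2, fun p hp hup => hmem _ (h3 p (mem_sortLength.1 hp).1 hup)⟩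
  have hpw : (closedFamily S).Pairwise fun p q => q.length ≤ p.length := pairwise_sortLength _ _
  -- shorter members come later, so they remain available in every final segment
  have key : ∀ (l₁ l₂ : List UPoly), closedFamily S = l₁ ++ l₂ → IsClosedChain l₂ := by
    intro l₁ l₂
    induction l₂ generalizing l₁ with
    | nil => intro _; exact .nil
    | cons u l₂ ih =>
      intro h
      have hrest := ih (l₁ ++ [u]) (by simp [h])
      rw [h] at hpw
      have hu : u ∈ closedFamily S := by rw [h]; simp
      have hpw2 := (List.pairwise_append.1 hpw)
      have hshort : ∀ v ∈ closedFamily S, v.length < u.length → v ∈ l₂ := by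
        intro v hv hlt
        rw [h, List.mem_append, List.mem_cons] at hv
        rcases hv with hv | rfl | hv
        · have := hpw2.2.2 v hv u List.mem_cons_self
          omega
        · omega
        · exact hv
      have hle : ∀ v ∈ l₂, v.length ≤ u.length := (List.pairwise_cons.1 hpw2.2.1).1
      have hin : ∀ v ∈ l₂, v ∈ closedFamily S := fun v hv => by rw [h]; simp [hv]
      refine .cons u l₂ hrest ?_ ?_ ?_
      · rcases u with _ | ⟨a, u⟩
        · exact Or.inr rfl
        · exact Or.inl (hshort _ (hcl _ hu (by simp)).1 (by simp))
      · rcases u with _ | ⟨a, u⟩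
        · exact Or.inr rfl
        · exact Or.inl (hshort _ (hcl _ hu (by simp)).2.1 (by simp [length_deriv]))
      · intro v hv hne
        have h0 : 0 < v.length := List.length_pos_iff.2 hne
        refine Or.inl (hshort _ ((hcl v (hin v hv) h0).2.2 u hu (hle v hv)) ?_)
        rw [length_prem u v (hle v hv) h0]
        have := hle v hv
        omega
  exact key [] _ rfl

end UPoly

/-! ### Signs of a real polynomial on an interval -/

/-- The neighbourhoods of an endpoint of an interval; those of a finite endpoint consist of the
endpoint only. -/
noncomputable def nearEnd (l : EReal) : Filter ℝ :=
  if l = ⊥ then atBot else if l = ⊤ then atTop else pure l.toReal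

@[simp] theorem nearEnd_bot : nearEnd ⊥ = atBot := by simp [nearEnd]

@[simp] theorem nearEnd_top : nearEnd ⊤ = atTop := by simp [nearEnd]

@[simp] theorem nearEnd_coe (r : ℝ) : nearEnd (r : EReal) = pure r := by simp [nearEnd]

instance (l : EReal) : (nearEnd l).NeBot := by
  induction l <;> simp <;> infer_instance

theorem eventually_nearEnd_left {l : EReal} {y : ℝ} (h : l < y) :
    ∀ᶠ x : ℝ in nearEnd l, l ≤ (x : EReal) ∧ x < y := by
  induction l with
  | bot => simpa using eventually_lt_atBot y
  | coe r => simpa using h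
  | top => simp at h

theorem eventually_nearEnd_right {r : EReal} {y : ℝ} (h : (y : EReal) < r) :
    ∀ᶠ x : ℝ in nearEnd r, (x : EReal) ≤ r ∧ y < x := by
  induction r with
  | bot => simp at h
  | coe r => simpa using h
  | top => simpa using eventually_gt_atTop y

theorem exists_real_between {l r : EReal} (h : l < r) : ∃ y : ℝ, l < y ∧ (y : EReal) < r := by
  obtain ⟨y, h1, h2⟩ := EReal.lt_iff_exists_real_btwn.1 h
  exact ⟨y, h1, h2⟩

/-- A strictly increasing function with signs `sl` and `sr` at the ends of an interval has exactly
one zero inside if these signs are opposite; otherwise it has a constant sign inside, namely `sl`,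
or `sr` if `sl` is zero. -/
theorem sign_interval_of_strictMonoOn {f : ℝ → ℝ} (hf : Continuous f) {l r : EReal}
    (hlr : l < r) {sl sr : SignType}
    (hsl : ∀ᶠ x in nearEnd l, SignType.sign (f x) = sl)
    (hsr : ∀ᶠ x in nearEnd r, SignType.sign (f x) = sr)
    (hmono : StrictMonoOn f {x : ℝ | l ≤ x ∧ (x : EReal) ≤ r}) :
    if sl * sr = -1 then
      ∃ c : ℝ, l < c ∧ (c : EReal) < r ∧ f c = 0 ∧
        (∀ x : ℝ, l < x → x < c → SignType.sign (f x) = sl) ∧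
        (∀ x : ℝ, c < x → (x : EReal) < r → SignType.sign (f x) = sr)
    else ∀ x : ℝ, l < x → (x : EReal) < r →
      SignType.sign (f x) = if sl = 0 then sr else sl := by
  have key : ∀ y : ℝ, l < y → (y : EReal) < r → ∃ a b : ℝ, a < y ∧ y < b ∧ l ≤ a ∧ (b : EReal) ≤ r ∧
      f a < f y ∧ f y < f b ∧ SignType.sign (f a) = sl ∧ SignType.sign (f b) = sr := by
    intro y hly hyr
    obtain ⟨a, ha, hsa⟩ := ((eventually_nearEnd_left hly).and hsl).exists
    obtain ⟨b, hb, hsb⟩ := ((eventually_nearEnd_right hyr).and hsr).exists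
    have hay : (a : EReal) ≤ y := by exact_mod_cast ha.2.le
    have hyb : (y : EReal) ≤ b := by exact_mod_cast hb.2.le
    exact ⟨a, b, ha.2, hb.2, ha.1, hb.1,
      hmono ⟨ha.1, hay.trans hyr.le⟩ ⟨hly.le, hyr.le⟩ ha.2,
      hmono ⟨hly.le, hyr.le⟩ ⟨hly.le.trans hyb, hb.1⟩ hb.2, hsa, hsb⟩
  by_cases h : sl * sr = -1
  · rw [if_pos h]
    obtain ⟨y, hly, hyr⟩ := exists_real_between hlr
    obtain ⟨a, b, hay, hyb, hla, hbr, hfa, hfb, hsa, hsb⟩ := key y hly hyr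
    have hab : f a < f b := hfa.trans hfb
    have hs : ∀ s t : SignType, s * t = -1 → (s = -1 ∧ t = 1) ∨ (s = 1 ∧ t = -1) := by decide
    rcases hs sl sr h with ⟨rfl, rfl⟩ | ⟨rfl, rfl⟩
    swap
    · have ha0 : 0 < f a := sign_eq_one_iff.1 hsa
      have hb0 : f b < 0 := sign_eq_neg_one_iff.1 hsb
      linarith
    have ha0 : f a < 0 := sign_eq_neg_one_iff.1 hsa
    have hb0 : 0 < f b := sign_eq_one_iff.1 hsb
    obtain ⟨c, hc, hc0⟩ := intermediate_value_Ioo (hay.trans hyb).le hf.continuousOn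
      (show (0 : ℝ) ∈ Set.Ioo (f a) (f b) from ⟨ha0, hb0⟩)
    have hlc : l < c := hla.trans_lt (by exact_mod_cast hc.1)
    have hcr : (c : EReal) < r := lt_of_lt_of_le (by exact_mod_cast hc.2) hbr
    refine ⟨c, hlc, hcr, hc0, fun x hx hxc => ?_, fun x hx hxr => ?_⟩
    · have hxc' : (x : EReal) < c := by exact_mod_cast hxc
      have := hmono ⟨hx.le, (hxc'.trans hcr).le⟩ ⟨hlc.le, hcr.le⟩ hxc
      exact sign_neg (by linarith)
    · have hxc' : (c : EReal) < x := by exact_mod_cast hx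
      have := hmono ⟨hlc.le, hcr.le⟩ ⟨(hlc.trans hxc').le, hxr.le⟩ hx
      exact sign_pos (by linarith)
  · rw [if_neg h]
    intro y hly hyr
    obtain ⟨a, b, hay, hyb, hla, hbr, hfa, hfb, hsa, hsb⟩ := key y hly hyr
    have hab : f a < f b := hfa.trans hfb
    rw [← hsa, ← hsb] at h ⊢
    rcases lt_trichotomy (f a) 0 with h1 | h1 | h1
    · rcases lt_trichotomy (f b) 0 with h2 | h2 | h2
      · rw [sign_neg h1, sign_neg (by linarith)]; rfl
      · rw [sign_neg h1, sign_neg (by linarith)]; rfl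
      · exact absurd (by rw [sign_neg h1, sign_pos h2]; rfl) h
    · rw [h1, sign_zero, if_pos rfl, sign_pos (by linarith), sign_pos (by linarith)]
    · rw [sign_pos h1, sign_pos (by linarith)]; rfl

theorem sign_interval_of_strictAntiOn {f : ℝ → ℝ} (hf : Continuous f) {l r : EReal}
    (hlr : l < r) {sl sr : SignType}
    (hsl : ∀ᶠ x in nearEnd l, SignType.sign (f x) = sl)
    (hsr : ∀ᶠ x in nearEnd r, SignType.sign (f x) = sr)
    (hmono : StrictAntiOn f {x : ℝ | l ≤ x ∧ (x : EReal) ≤ r}) :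
    if sl * sr = -1 then
      ∃ c : ℝ, l < c ∧ (c : EReal) < r ∧ f c = 0 ∧
        (∀ x : ℝ, l < x → x < c → SignType.sign (f x) = sl) ∧
        (∀ x : ℝ, c < x → (x : EReal) < r → SignType.sign (f x) = sr)
    else ∀ x : ℝ, l < x → (x : EReal) < r →
      SignType.sign (f x) = if sl = 0 then sr else sl := by
  have hneg : ∀ (y : ℝ) (s : SignType), SignType.sign (-y) = -s ↔ SignType.sign y = s := by
    intro y s
    rw [Left.sign_neg, neg_inj]
  have h := sign_interval_of_strictMonoOn (f := fun x => -f x) hf.neg hlr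
    (sl := -sl) (sr := -sr) (by simpa only [hneg] using hsl) (by simpa only [hneg] using hsr)
    (fun x hx y hy hxy => neg_lt_neg (hmono hx hy hxy))
  have e1 : -sl * -sr = sl * sr := by cases sl <;> cases sr <;> rfl
  have e2 : (if -sl = 0 then -sr else -sl) = -(if sl = 0 then sr else sl) := by
    cases sl <;> cases sr <;> rfl
  simpa only [e1, e2, hneg, neg_eq_zero] using h

/-- The sign of a polynomial near plus infinity. -/
theorem eventually_sign_eval_atTop (f : ℝ[X]) :
    ∀ᶠ x in atTop, SignType.sign (f.eval x) = SignType.sign f.leadingCoeff := by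
  obtain ⟨φ, hφ, h⟩ := (Polynomial.isEquivalent_atTop_lead f).exists_eq_mul
  filter_upwards [h, hφ.eventually (lt_mem_nhds one_pos), eventually_gt_atTop 0] with x hx h1 h0
  rw [hx]
  simp only [Pi.mul_apply, sign_mul]
  rw [sign_pos h1, sign_pos (pow_pos h0 _), one_mul, mul_one]

/-- The sign of a polynomial near minus infinity. -/
theorem eventually_sign_eval_atBot (f : ℝ[X]) :
    ∀ᶠ x in atBot, SignType.sign (f.eval x) =
      SignType.sign f.leadingCoeff * (-1) ^ f.natDegree := by
  have h := tendsto_neg_atBot_atTop.eventually (eventually_sign_eval_atTop (f.comp (-X)))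
  filter_upwards [h] with x hx
  simp only [eval_comp, eval_neg, eval_X, neg_neg] at hx
  rw [hx, Polynomial.comp_neg_X_leadingCoeff_eq, sign_mul, mul_comm]
  congr 1
  rw [sign_pow, sign_neg (by norm_num : (-1 : ℝ) < 0)]

end VolumePolynomial

namespace VolumePolynomial

open Polynomial Filter Topology CoeffPoly UPoly

/-! ### Sign diagrams -/

/-- A column of a sign diagram: polynomials, each with the sign of its formal leading coefficient
and with its sign at a point or on an interval. -/
abbrev Column : Type := List (UPoly × SignType × SignType)

/-- A sign diagram: a decomposition of the line into points and intervals, from the left to the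
right, in which every interval is paired with its left endpoint (first, with minus infinity). -/
abbrev Diagram : Type := List (Column × Column)

namespace Column

/-- The sign of `u` that is recorded in a column (zero for the empty polynomial). -/
def lookup (c : Column) (u : UPoly) : SignType :=
  (c.find? fun e => decide (e.1 = u)).elim 0 fun e => e.2.2

/-- The sign of `u` at the left endpoint of an interval: at a finite endpoint some polynomial `q` of
the column has a root, and `u` may be replaced by its pseudo-remainder by `q`; at minus infinity
the sign is that of the leading term. -/
def endpointSign (u : UPoly) (h : SignType) (c : Column) : SignType :=
  (c.find? fun e => decide ((¬ e.2.1 = 0) ∧ e.2.2 = 0)).elim (h * (-1) ^ (u.length - 1))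
    fun e => lookup c (prem u e.1)

end Column

namespace Diagram

/-- Insertion of `u` into the interval `I` with left endpoint `P`. The pair `s` consists of the sign
of `u` at the right endpoint and of the part of the new diagram that begins there; the polynomial
is assumed to be strictly monotone on the interval or constant. -/
def insertStep (u : UPoly) (h : SignType) (p : Column × Column) (s : SignType × Diagram) :
    SignType × Diagram :=
  (Column.endpointSign u h p.1,
    if Column.endpointSign u h p.1 * s.1 = -1 then
      ((u, h, Column.endpointSign u h p.1) :: p.1, (u, h, Column.endpointSign u h p.1) :: p.2) ::
        ((u, h, 0) :: p.2, (u, h, s.1) :: p.2) :: s.2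
    else
      ((u, h, Column.endpointSign u h p.1) :: p.1,
        (u, h, if Column.endpointSign u h p.1 = 0 then s.1 else Column.endpointSign u h p.1) :: p.2)
        :: s.2)

/-- The diagram obtained by adding the polynomial `u` with leading coefficient of sign `h`. -/
def insert (u : UPoly) (h : SignType) (D : Diagram) : Diagram :=
  if h = 0 then
    D.map fun p =>
      ((u, h, Column.lookup p.1 u.tail) :: p.1, (u, h, Column.lookup p.2 u.tail) :: p.2)
  else (D.foldr (fun p s => insertStep u h p s) (h, [])).2

/-- The sign diagram of a list of polynomials with given signs of the leading coefficients. -/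
def ofSigns (σ : List (UPoly × SignType)) : Diagram :=
  σ.foldr (fun e D => insert e.1 e.2 D) [([], [])]

/-- All columns of a diagram. -/
def columns (D : Diagram) : List Column := D.flatMap fun p => [p.1, p.2]

end Diagram

section Primrec

variable {α : Type*} [Primcodable α]

@[fun_prop]
theorem Column.lookup_primrec (c : α → Column) (u : α → UPoly) (hc : Primrec c)
    (hu : Primrec u) : Primrec (fun x => Column.lookup (c x) (u x)) := by
  unfold Column.lookup; fun_prop

@[fun_prop]
theorem Column.endpointSign_primrec (u : α → UPoly) (h : α → SignType) (c : α → Column)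
    (hu : Primrec u) (hh : Primrec h) (hc : Primrec c) :
    Primrec (fun x => Column.endpointSign (u x) (h x) (c x)) := by
  unfold Column.endpointSign; fun_prop

@[fun_prop]
theorem Diagram.insertStep_primrec (u : α → UPoly) (h : α → SignType) (p : α → Column × Column)
    (s : α → SignType × Diagram) (hu : Primrec u) (hh : Primrec h) (hp : Primrec p)
    (hs : Primrec s) : Primrec (fun x => Diagram.insertStep (u x) (h x) (p x) (s x)) := by
  unfold Diagram.insertStep
  fun_prop

@[fun_prop]
theorem Diagram.insert_primrec (u : α → UPoly) (h : α → SignType) (D : α → Diagram)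
    (hu : Primrec u) (hh : Primrec h) (hD : Primrec D) :
    Primrec (fun x => Diagram.insert (u x) (h x) (D x)) := by
  unfold Diagram.insert
  fun_prop

@[fun_prop]
theorem Diagram.ofSigns_primrec (σ : α → List (UPoly × SignType)) (hσ : Primrec σ) :
    Primrec (fun x => Diagram.ofSigns (σ x)) := by
  unfold Diagram.ofSigns
  fun_prop

@[fun_prop]
theorem Diagram.columns_primrec (D : α → Diagram) (hD : Primrec D) :
    Primrec (fun x => Diagram.columns (D x)) := by
  unfold Diagram.columns
  fun_prop

end Primrec

variable (ρ : List ℕ → ℝ)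

/-- The column `c` records the polynomials of `σ` with their true signs at `x`. -/
def Column.IsCorrect (σ : List (UPoly × SignType)) (c : Column) (x : ℝ) : Prop :=
  (c.map fun e => (e.1, e.2.1)) = σ ∧
    ∀ e ∈ c, e.2.2 = SignType.sign ((toPoly ρ e.1).eval x)

/-- The list `D` is the part of the sign diagram of the polynomials of `σ` to the right of `l`. At
every finite endpoint, some polynomial with nonzero leading coefficient has a root. -/
def Diagram.IsCorrect (σ : List (UPoly × SignType)) : EReal → Diagram → Prop
  | l, [] => l = ⊤
  | l, p :: D => (∀ᶠ x in nearEnd l, p.1.IsCorrect ρ σ x) ∧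
      (l ≠ ⊥ → ∃ e ∈ p.1, e.2.1 ≠ 0 ∧ e.2.2 = 0) ∧
      ∃ r, l < r ∧ (∀ x : ℝ, l < x → (x : EReal) < r → p.2.IsCorrect ρ σ x) ∧
        Diagram.IsCorrect σ r D

/-- The signs in `σ` are the true signs of the formal leading coefficients. -/
def HeadSigns (σ : List (UPoly × SignType)) : Prop :=
  ∀ e ∈ σ, SignType.sign (ev ρ (head e.1)) = e.2

variable {ρ}

theorem Column.IsCorrect.lookup_eq {σ : List (UPoly × SignType)} {c : Column} {x : ℝ}
    (hc : c.IsCorrect ρ σ x) {u : UPoly} (hu : u ∈ σ.map Prod.fst ∨ u = []) :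
    c.lookup u = SignType.sign ((toPoly ρ u).eval x) := by
  rw [Column.lookup]
  generalize h : List.find? _ c = o
  rcases o with _ | e
  · rcases hu with hu | rfl
    · rw [← hc.1, List.map_map] at hu
      obtain ⟨e, he, rfl⟩ := List.mem_map.1 hu
      exact absurd (List.find?_eq_none.1 h e he) (by simp)
    · simp
  · have h1 := List.find?_some h
    have h2 := hc.2 e (List.mem_of_find?_eq_some h)
    simp only [decide_eq_true_eq] at h1
    simp [h2, h1]

theorem Column.IsCorrect.cons {σ : List (UPoly × SignType)} {c : Column} {x : ℝ}
    (hc : c.IsCorrect ρ σ x) {u : UPoly} {h s : SignType}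
    (hs : s = SignType.sign ((toPoly ρ u).eval x)) :
    Column.IsCorrect ρ ((u, h) :: σ) ((u, h, s) :: c) x := by
  refine ⟨by simp [hc.1], ?_⟩
  intro e he
  rcases List.mem_cons.1 he with rfl | he
  · exact hs
  · exact hc.2 e he

/-- The conditions under which `u` can be added to the diagram of the polynomials of `σ`. -/
structure Insertable (σ : List (UPoly × SignType)) (u : UPoly) : Prop where
  tail : u.tail ∈ σ.map Prod.fst ∨ u.tail = []
  deriv : deriv u ∈ σ.map Prod.fst ∨ deriv u = []
  prem : ∀ v ∈ σ.map Prod.fst, v ≠ [] → prem u v ∈ σ.map Prod.fst ∨ prem u v = []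

theorem endpointSign_correct {σ : List (UPoly × SignType)} (hσ : HeadSigns ρ σ) {u : UPoly}
    (hu : Insertable σ u) {h : SignType} (hh : SignType.sign (ev ρ (head u)) = h) (h0 : h ≠ 0)
    {l : EReal} (hl : l ≠ ⊤) {c : Column} (hc : ∀ᶠ x in nearEnd l, c.IsCorrect ρ σ x)
    (hroot : l ≠ ⊥ → ∃ e ∈ c, e.2.1 ≠ 0 ∧ e.2.2 = 0) :
    ∀ᶠ x in nearEnd l, SignType.sign ((toPoly ρ u).eval x) = c.endpointSign u h := by
  have hu0 : ev ρ (head u) ≠ 0 := by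
    rintro h1
    rw [h1, sign_zero] at hh
    exact h0 hh.symm
  have hne : ∀ x, c.IsCorrect ρ σ x → ∀ e ∈ c, e.2.1 ≠ 0 →
      ev ρ (head e.1) ≠ 0 ∧ e.1 ∈ σ.map Prod.fst ∧ e.1 ≠ [] := by
    intro x hx e he he0
    have hmem : (e.1, e.2.1) ∈ σ := by
      rw [← hx.1]
      exact List.mem_map.2 ⟨e, he, rfl⟩
    have h1 : ev ρ (head e.1) ≠ 0 := by
      intro h1
      have := hσ _ hmem
      simp only [h1, sign_zero] at this
      exact he0 this.symm
    refine ⟨h1, List.mem_map.2 ⟨_, hmem, rfl⟩, ?_⟩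
    intro h2
    rw [h2] at h1
    simp [head] at h1
  rw [Column.endpointSign]
  generalize hf : List.find? _ c = o
  rcases o with _ | e
  · have hbot : l = ⊥ := by
      by_contra hb
      obtain ⟨e, he, h1, h2⟩ := hroot hb
      exact absurd (List.find?_eq_none.1 hf e he) (by simp [h1, h2])
    subst hbot
    rw [nearEnd_bot]
    filter_upwards [eventually_sign_eval_atBot (toPoly ρ u)] with x hx
    obtain ⟨h1, h2⟩ := natDegree_leadingCoeff ρ u hu0
    rw [hx, h1, h2, hh]
    rfl
  · have h1 := List.find?_some hf
    have he := List.mem_of_find?_eq_some hf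
    simp only [decide_eq_true_eq] at h1
    simp only [Option.elim_some]
    induction l with
    | top => exact absurd rfl hl
    | bot =>
      rw [nearEnd_bot] at hc
      obtain ⟨x, hx, hx2⟩ := (hc.and (eventually_sign_eval_atBot (toPoly ρ e.1))).exists
      obtain ⟨h2, -, -⟩ := hne x hx e he h1.1
      have h3 := hx.2 e he
      rw [h1.2, hx2, (natDegree_leadingCoeff ρ _ h2).2, ← sign_neg (show (-1 : ℝ) < 0 by norm_num),
        ← sign_pow, ← sign_mul, eq_comm, sign_eq_zero_iff] at h3
      simp [h2] at h3
    | coe r =>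
      rw [nearEnd_coe] at hc ⊢
      rw [eventually_pure] at hc ⊢
      obtain ⟨h2, h3, h4⟩ := hne r hc e he h1.1
      have h5 : (toPoly ρ e.1).eval r = 0 := by
        have := hc.2 e he
        rw [h1.2, eq_comm, sign_eq_zero_iff] at this
        exact this
      rw [hc.lookup_eq (hu.prem _ h3 h4), sign_eval_prem ρ u e.1 h2 h5]

/-- The signs of `u` on an interval of the diagram follow from those at its ends: the derivative is
a member of the family, so it has a constant sign on the interval. -/
theorem interval_signs {σ : List (UPoly × SignType)} {u : UPoly}
    (hu : Insertable σ u) {h : SignType} (hh : SignType.sign (ev ρ (head u)) = h) (h0 : h ≠ 0)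
    {l r : EReal} (hlr : l < r) {c : Column}
    (hc : ∀ x : ℝ, l < x → (x : EReal) < r → c.IsCorrect ρ σ x) {sl sr : SignType}
    (hsl : ∀ᶠ x in nearEnd l, SignType.sign ((toPoly ρ u).eval x) = sl)
    (hsr : ∀ᶠ x in nearEnd r, SignType.sign ((toPoly ρ u).eval x) = sr) :
    if sl * sr = -1 then
      ∃ c : ℝ, l < c ∧ (c : EReal) < r ∧ (toPoly ρ u).eval c = 0 ∧
        (∀ x : ℝ, l < x → x < c → SignType.sign ((toPoly ρ u).eval x) = sl) ∧
        (∀ x : ℝ, c < x → (x : EReal) < r → SignType.sign ((toPoly ρ u).eval x) = sr)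
    else ∀ x : ℝ, l < x → (x : EReal) < r →
      SignType.sign ((toPoly ρ u).eval x) = if sl = 0 then sr else sl := by
  have hu0 : ev ρ (head u) ≠ 0 := by
    rintro h1
    rw [h1, sign_zero] at hh
    exact h0 hh.symm
  obtain ⟨hdeg, -⟩ := natDegree_leadingCoeff ρ u hu0
  by_cases hlen : u.length ≤ 1
  · obtain ⟨a, ha⟩ := natDegree_eq_zero.1 (show (toPoly ρ u).natDegree = 0 by omega)
    rw [← ha] at hsl hsr ⊢
    simp only [eval_C] at hsl hsr ⊢
    have h1 := hsl.exists.choose_spec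
    have h2 := hsr.exists.choose_spec
    rw [← h1, ← h2]
    have h3 : ∀ s : SignType, s * s ≠ -1 := by decide
    rw [if_neg (h3 _)]
    simp
  · -- the derivative is one of the polynomials of the diagram, hence of constant sign
    have hder : ∀ x : ℝ, l < x → (x : EReal) < r →
        SignType.sign ((derivative (toPoly ρ u)).eval x) = c.lookup (UPoly.deriv u) := by
      intro x h1 h2
      rw [(hc x h1 h2).lookup_eq hu.deriv, toPoly_deriv]
    have hder0 : derivative (toPoly ρ u) ≠ 0 := by
      intro h1
      have := derivative_eq_zero.1 h1
      omega
    have hinf : {x : ℝ | l < x ∧ (x : EReal) < r}.Infinite := by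
      obtain ⟨y, h1, h2⟩ := exists_real_between hlr
      obtain ⟨z, h3, h4⟩ := exists_real_between h2
      have hyz : y < z := by exact_mod_cast h3
      refine (Set.Ioo_infinite hyz).mono fun x hx => ⟨?_, ?_⟩
      · exact h1.trans (by exact_mod_cast hx.1)
      · exact lt_trans (by exact_mod_cast hx.2) h4
    have hmid : ∀ x y z : ℝ, l ≤ x → (y : EReal) ≤ r → z ∈ Set.Ioo x y →
        l < z ∧ (z : EReal) < r := fun x y z hx hy hz =>
      ⟨hx.trans_lt (by exact_mod_cast hz.1), lt_of_lt_of_le (by exact_mod_cast hz.2) hy⟩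
    rcases hδ : c.lookup (UPoly.deriv u) with _ | _ | _
    · exfalso
      refine hder0 (eq_zero_of_infinite_isRoot _ (hinf.mono fun x hx => ?_))
      have := hder x hx.1 hx.2
      rw [hδ] at this
      exact sign_eq_zero_iff.1 this
    · refine sign_interval_of_strictAntiOn (toPoly ρ u).continuous hlr hsl hsr ?_
      intro x hx y hy hxy
      refine strictAntiOn_of_deriv_neg (convex_Icc x y) (toPoly ρ u).continuous.continuousOn ?_
        (Set.left_mem_Icc.2 hxy.le) (Set.right_mem_Icc.2 hxy.le) hxy
      intro z hz
      rw [interior_Icc] at hz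
      obtain ⟨h1, h2⟩ := hmid x y z hx.1 hy.2 hz
      have := hder z h1 h2
      rw [hδ] at this
      rw [Polynomial.deriv]
      exact sign_eq_neg_one_iff.1 this
    · refine sign_interval_of_strictMonoOn (toPoly ρ u).continuous hlr hsl hsr ?_
      intro x hx y hy hxy
      refine strictMonoOn_of_deriv_pos (convex_Icc x y) (toPoly ρ u).continuous.continuousOn ?_
        (Set.left_mem_Icc.2 hxy.le) (Set.right_mem_Icc.2 hxy.le) hxy
      intro z hz
      rw [interior_Icc] at hz
      obtain ⟨h1, h2⟩ := hmid x y z hx.1 hy.2 hz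
      have := hder z h1 h2
      rw [hδ] at this
      rw [Polynomial.deriv]
      exact sign_eq_one_iff.1 this

/-- Insertion of a polynomial with nonzero leading coefficient is correct. The fold runs from plus
infinity to the left and carries along the sign of `u` at the current endpoint. -/
theorem insertFold_correct {σ : List (UPoly × SignType)} (hσ : HeadSigns ρ σ) {u : UPoly}
    (hu : Insertable σ u) {h : SignType} (hh : SignType.sign (ev ρ (head u)) = h) (h0 : h ≠ 0)
    (D : Diagram) (l : EReal) (hD : D.IsCorrect ρ σ l) :
    Diagram.IsCorrect ρ ((u, h) :: σ) l
        (D.foldr (fun p s => Diagram.insertStep u h p s) (h, [])).2 ∧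
      ∀ᶠ x in nearEnd l, SignType.sign ((toPoly ρ u).eval x) =
        (D.foldr (fun p s => Diagram.insertStep u h p s) (h, [])).1 := by
  induction D generalizing l with
  | nil =>
    obtain rfl : l = ⊤ := hD
    refine ⟨rfl, ?_⟩
    have hu0 : ev ρ (head u) ≠ 0 := by
      rintro h1
      rw [h1, sign_zero] at hh
      exact h0 hh.symm
    rw [nearEnd_top]
    filter_upwards [eventually_sign_eval_atTop (toPoly ρ u)] with x hx
    rw [hx, (natDegree_leadingCoeff ρ u hu0).2, hh]
    rfl
  | cons p D ih =>
    obtain ⟨hP, hroot, r, hlr, hI, hrest⟩ := hD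
    obtain ⟨ih1, ih2⟩ := ih r hrest
    rw [List.foldr_cons]
    set s := D.foldr (fun p s => Diagram.insertStep u h p s) (h, []) with hs
    have hsl := endpointSign_correct hσ hu hh h0 hlr.ne_top hP hroot
    have hint := interval_signs hu hh h0 hlr hI hsl ih2
    refine ⟨?_, hsl⟩
    have hP' : ∀ᶠ x in nearEnd l, Column.IsCorrect ρ ((u, h) :: σ)
        ((u, h, Column.endpointSign u h p.1) :: p.1) x := by
      filter_upwards [hP, hsl] with x hx1 hx2
      exact hx1.cons hx2.symm
    have hroot' : l ≠ ⊥ → ∃ e ∈ (u, h, Column.endpointSign u h p.1) :: p.1,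
        e.2.1 ≠ 0 ∧ e.2.2 = 0 := by
      intro hl
      obtain ⟨e, he, h1⟩ := hroot hl
      exact ⟨e, List.mem_cons_of_mem _ he, h1⟩
    by_cases hneg : Column.endpointSign u h p.1 * s.1 = -1
    · rw [if_pos hneg] at hint
      obtain ⟨c, hlc, hcr, hc0, hleft, hright⟩ := hint
      simp only [Diagram.insertStep, if_pos hneg]
      refine ⟨hP', hroot', c, hlc, fun x h1 h2 => ?_, ?_, fun _ => ?_, r, hcr,
        fun x h1 h2 => ?_, ih1⟩
      · exact (hI x h1 (h2.trans hcr)).cons (hleft x h1 (by exact_mod_cast h2)).symm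
      · rw [nearEnd_coe, eventually_pure]
        exact (hI c hlc hcr).cons (by rw [hc0, sign_zero])
      · exact ⟨_, List.mem_cons_self, h0, rfl⟩
      · exact (hI x (hlc.trans h1) h2).cons (hright x (by exact_mod_cast h1) h2).symm
    · rw [if_neg hneg] at hint
      simp only [Diagram.insertStep, if_neg hneg]
      exact ⟨hP', hroot', r, hlr, fun x h1 h2 => (hI x h1 h2).cons (hint x h1 h2).symm, ih1⟩

/-- A polynomial with vanishing leading coefficient has the signs of its tail. -/
theorem insert_correct {σ : List (UPoly × SignType)} (hσ : HeadSigns ρ σ) {u : UPoly}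
    (hu : Insertable σ u) {h : SignType} (hh : SignType.sign (ev ρ (head u)) = h)
    (D : Diagram) (l : EReal) (hD : D.IsCorrect ρ σ l) :
    Diagram.IsCorrect ρ ((u, h) :: σ) l (Diagram.insert u h D) := by
  by_cases h0 : h = 0
  · rw [Diagram.insert, if_pos h0]
    have htail : ∀ x, (toPoly ρ u).eval x = (toPoly ρ u.tail).eval x := by
      intro x
      rcases u with _ | ⟨a, u⟩
      · rfl
      · have : ev ρ a = 0 := by
          rw [h0, sign_eq_zero_iff] at hh
          exact hh
        rw [toPoly_cons, this]
        simp
    have hcol : ∀ (c : Column) (x : ℝ), c.IsCorrect ρ σ x →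
        Column.IsCorrect ρ ((u, h) :: σ) ((u, h, c.lookup u.tail) :: c) x := by
      intro c x hc
      exact hc.cons (by rw [hc.lookup_eq hu.tail, htail])
    clear hh
    induction D generalizing l with
    | nil => exact hD
    | cons p D ih =>
      obtain ⟨hP, hroot, r, hlr, hI, hrest⟩ := hD
      refine ⟨hP.mono fun x hx => hcol _ x hx, fun hl => ?_, r, hlr,
        fun x h1 h2 => hcol _ x (hI x h1 h2), ih r hrest⟩
      obtain ⟨e, he, h1⟩ := hroot hl
      exact ⟨e, List.mem_cons_of_mem _ he, h1⟩
  · rw [Diagram.insert, if_neg h0]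
    exact (insertFold_correct hσ hu hh h0 D l hD).1

/-- The sign diagram of a closed chain depends on nothing but the signs of the formal leading
coefficients of its members. -/
theorem ofSigns_correct {σ : List (UPoly × SignType)} (hσ : HeadSigns ρ σ)
    (hcl : IsClosedChain (σ.map Prod.fst)) :
    Diagram.IsCorrect ρ σ ⊥ (Diagram.ofSigns σ) := by
  induction σ with
  | nil =>
    have hnil : ∀ x, Column.IsCorrect ρ [] [] x := fun x => ⟨rfl, by simp⟩
    exact ⟨Eventually.of_forall hnil, fun h => absurd rfl h, ⊤, bot_lt_top,
      fun x _ _ => hnil x, rfl⟩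
  | cons e σ ih =>
    rw [List.map_cons] at hcl
    rcases hcl with _ | ⟨_, _, h1, h2, h3, h4⟩
    exact insert_correct (fun e he => hσ e (List.mem_cons_of_mem _ he)) ⟨h2, h3, h4⟩
      (hσ e List.mem_cons_self) _ _ (ih (fun e he => hσ e (List.mem_cons_of_mem _ he)) h1)

theorem Diagram.IsCorrect.exists_point {σ : List (UPoly × SignType)} {D : Diagram} {l : EReal}
    (hD : D.IsCorrect ρ σ l) : ∀ c ∈ D.columns, ∃ x, c.IsCorrect ρ σ x := by
  induction D generalizing l with
  | nil => simp [Diagram.columns]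
  | cons p D ih =>
    obtain ⟨hP, hroot, r, hlr, hI, hrest⟩ := hD
    intro c hc
    have hc' : c = p.1 ∨ c = p.2 ∨ c ∈ Diagram.columns D := by
      simpa [Diagram.columns, or_assoc] using hc
    rcases hc' with rfl | rfl | hc
    · exact hP.exists
    · obtain ⟨y, h1, h2⟩ := exists_real_between hlr
      exact ⟨y, hI y h1 h2⟩
    · exact ih hrest c hc

theorem Diagram.IsCorrect.exists_column {σ : List (UPoly × SignType)} {D : Diagram} {l : EReal}
    (hD : D.IsCorrect ρ σ l) (x : ℝ) (hx : l ≤ x) : ∃ c ∈ D.columns, c.IsCorrect ρ σ x := by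
  induction D generalizing l with
  | nil =>
    obtain rfl : l = ⊤ := hD
    simp at hx
  | cons p D ih =>
    obtain ⟨hP, hroot, r, hlr, hI, hrest⟩ := hD
    rcases hx.eq_or_lt with rfl | hlx
    · rw [nearEnd_coe, eventually_pure] at hP
      exact ⟨p.1, by simp [Diagram.columns], hP⟩
    · rcases lt_or_ge (x : EReal) r with h | h
      · exact ⟨p.2, by simp [Diagram.columns], hI x hlx h⟩
      · obtain ⟨c, hc, h1⟩ := ih hrest h
        refine ⟨c, ?_, h1⟩
        simp only [Diagram.columns, List.flatMap_cons, List.mem_append] at hc ⊢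
        exact Or.inr hc

end VolumePolynomial

namespace VolumePolynomial

open CoeffPoly UPoly

/-! ### Quantifier elimination over the real numbers -/

namespace SignFormula

/-- The truth of an atom for given values of the indeterminates. -/
def AtomHolds (ρ : List ℕ → ℝ) (a : Bool × CoeffPoly) : Prop :=
  (a.1 = true ∧ 0 < ev ρ a.2) ∨ (a.1 = false ∧ ev ρ a.2 = 0)

/-- The truth of a formula for given values of the indeterminates. -/
def Sat (ρ : List ℕ → ℝ) (Φ : SignFormula) : Prop :=
  ∃ conj ∈ Φ, ∀ a ∈ conj, AtomHolds ρ a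

/-- The atom saying that the formal leading coefficient of a polynomial has a given sign. -/
def headAtom (e : UPoly × SignType) : Bool × CoeffPoly :=
  if e.2 = 0 then (false, head e.1) else if e.2 = 1 then (true, head e.1)
    else (true, smul (-1) (head e.1))

/-- All assignments of signs to the members of a list. -/
def signAssignments (R : List UPoly) : List (List (UPoly × SignType)) :=
  R.foldr (fun u A => A.flatMap fun σ => [(u, 0) :: σ, (u, 1) :: σ, (u, -1) :: σ]) [[]]

/-- The signs in the column `c` make the atoms in `conj` true, where an atom is regarded as a
condition on a univariate polynomial in `v`. -/
def columnTest (v : List ℕ) (conj : List (Bool × CoeffPoly)) (c : Column) : Bool :=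
  conj.all fun a => decide (c.lookup (ofCoeffPoly v a.2) = if a.1 = true then 1 else 0)

/-- Elimination of the quantifier `∃ v` in front of a conjunction: the disjunction over those signs
of the leading coefficients of the closed family for which a column of the sign diagram makes all
atoms true. -/
def elimConj (v : List ℕ) (conj : List (Bool × CoeffPoly)) : SignFormula :=
  ((signAssignments (closedFamily (conj.map fun a => ofCoeffPoly v a.2))).filter fun σ =>
    (Diagram.columns (Diagram.ofSigns σ)).any fun c => columnTest v conj c).map
      fun σ => σ.map fun e => headAtom e

/-- Elimination of the quantifier `∃ v` in front of a formula. -/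
def elim (v : List ℕ) (Φ : SignFormula) : SignFormula := Φ.flatMap fun conj => elimConj v conj

/-- Elimination of a block of existential quantifiers. -/
def elimAll (vs : List (List ℕ)) (Φ : SignFormula) : SignFormula :=
  vs.foldr (fun v Ψ => elim v Ψ) Φ

/-- Conjunction. -/
def conj (Φ Ψ : SignFormula) : SignFormula := Φ.flatMap fun c => Ψ.map fun c' => c ++ c'

/-- Negation of an atom. -/
def negAtom (a : Bool × CoeffPoly) : SignFormula :=
  [[(true, smul (-1) a.2)], [(!a.1, a.2)]]

/-- Negation. -/
def neg (Φ : SignFormula) : SignFormula :=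
  Φ.foldr (fun c Ψ => conj (c.flatMap fun a => negAtom a) Ψ) [[]]

section Primrec

variable {α : Type*} [Primcodable α]

@[fun_prop]
theorem headAtom_primrec (e : α → UPoly × SignType) (he : Primrec e) :
    Primrec (fun x => headAtom (e x)) := by
  unfold headAtom; fun_prop

@[fun_prop]
theorem signAssignments_primrec (R : α → List UPoly) (hR : Primrec R) :
    Primrec (fun x => signAssignments (R x)) := by
  unfold signAssignments; fun_prop

@[fun_prop]
theorem columnTest_primrec (v : α → List ℕ) (conj : α → List (Bool × CoeffPoly))
    (c : α → Column) (hv : Primrec v) (hconj : Primrec conj) (hc : Primrec c) :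
    Primrec (fun x => columnTest (v x) (conj x) (c x)) := by
  unfold columnTest; fun_prop

@[fun_prop]
theorem elimConj_primrec (v : α → List ℕ) (conj : α → List (Bool × CoeffPoly))
    (hv : Primrec v) (hconj : Primrec conj) :
    Primrec (fun x => elimConj (v x) (conj x)) := by
  unfold elimConj; fun_prop

@[fun_prop]
theorem elim_primrec (v : α → List ℕ) (Φ : α → SignFormula)
    (hv : Primrec v) (hΦ : Primrec Φ) : Primrec (fun x => elim (v x) (Φ x)) := by
  unfold elim; fun_prop

@[fun_prop]
theorem elimAll_primrec (vs : α → List (List ℕ)) (Φ : α → SignFormula)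
    (hvs : Primrec vs) (hΦ : Primrec Φ) : Primrec (fun x => elimAll (vs x) (Φ x)) := by
  unfold elimAll; fun_prop

@[fun_prop]
theorem conj_primrec (Φ Ψ : α → SignFormula) (hΦ : Primrec Φ) (hΨ : Primrec Ψ) :
    Primrec (fun x => conj (Φ x) (Ψ x)) := by
  unfold conj; fun_prop

@[fun_prop]
theorem negAtom_primrec (a : α → Bool × CoeffPoly) (ha : Primrec a) :
    Primrec (fun x => negAtom (a x)) := by
  unfold negAtom; fun_prop

@[fun_prop]
theorem neg_primrec (Φ : α → SignFormula) (hΦ : Primrec Φ) :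
    Primrec (fun x => neg (Φ x)) := by
  unfold neg; fun_prop

end Primrec

variable (ρ : List ℕ → ℝ)

theorem atomHolds_iff_sign (a : Bool × CoeffPoly) :
    AtomHolds ρ a ↔ SignType.sign (ev ρ a.2) = if a.1 = true then 1 else 0 := by
  rcases a with ⟨b, p⟩
  cases b <;> simp [AtomHolds, sign_eq_one_iff]

theorem atomHolds_headAtom (e : UPoly × SignType) :
    AtomHolds ρ (headAtom e) ↔ SignType.sign (ev ρ (head e.1)) = e.2 := by
  rcases e with ⟨u, s⟩
  rcases s with _ | _ | _
  · simp [headAtom, AtomHolds]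
  · simp [headAtom, AtomHolds]
    exact sign_eq_neg_one_iff.symm
  · simp [headAtom, AtomHolds]
    exact sign_eq_one_iff.symm

theorem mem_signAssignments {R : List UPoly} {σ : List (UPoly × SignType)} :
    σ ∈ signAssignments R ↔ σ.map Prod.fst = R := by
  induction R generalizing σ with
  | nil => simp [signAssignments]
  | cons u R ih =>
    have h : signAssignments (u :: R) = (signAssignments R).flatMap fun σ =>
      [(u, 0) :: σ, (u, 1) :: σ, (u, -1) :: σ] := rfl
    rw [h, List.mem_flatMap]
    constructor
    · rintro ⟨τ, hτ, h1⟩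
      rw [ih] at hτ
      simp only [List.mem_cons, List.not_mem_nil, or_false] at h1
      rcases h1 with rfl | rfl | rfl <;> simp [hτ]
    · intro h1
      rcases σ with _ | ⟨⟨w, s⟩, σ⟩
      · simp at h1
      · simp only [List.map_cons, List.cons.injEq] at h1
        obtain ⟨rfl, h2⟩ := h1
        refine ⟨σ, ih.2 h2, ?_⟩
        rcases s with _ | _ | _
        · exact List.mem_cons_self
        · exact List.mem_cons_of_mem _ (List.mem_cons_of_mem _ List.mem_cons_self)
        · exact List.mem_cons_of_mem _ List.mem_cons_self

theorem columnTest_iff {σ : List (UPoly × SignType)} {v : List ℕ}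
    {conj : List (Bool × CoeffPoly)} {c : Column} {x : ℝ} (hc : c.IsCorrect ρ σ x)
    (hσ : ∀ a ∈ conj, ofCoeffPoly v a.2 ∈ σ.map Prod.fst) :
    columnTest v conj c = true ↔ ∀ a ∈ conj, AtomHolds (Function.update ρ v x) a := by
  rw [columnTest, List.all_eq_true]
  refine forall₂_congr fun a ha => ?_
  rw [decide_eq_true_iff, hc.lookup_eq (Or.inl (hσ a ha)), eval_ofCoeffPoly, atomHolds_iff_sign]

/-- The signs of the leading coefficients determine the sign diagram, and a value of `v` that makes
the atoms true exists if and only if one of its columns does so. -/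
theorem sat_elimConj (v : List ℕ) (conj : List (Bool × CoeffPoly)) :
    Sat ρ (elimConj v conj) ↔ ∃ x : ℝ, ∀ a ∈ conj, AtomHolds (Function.update ρ v x) a := by
  have hmem : ∀ a ∈ conj, ofCoeffPoly v a.2 ∈
      closedFamily (conj.map fun a => ofCoeffPoly v a.2) := fun a ha =>
    mem_closedFamily_of_mem (List.mem_map.2 ⟨a, ha, rfl⟩)
  have hchain := isClosedChain_closedFamily (conj.map fun a => ofCoeffPoly v a.2)
  constructor
  · rintro ⟨_, h1, h2⟩
    obtain ⟨σ, h3, rfl⟩ := List.mem_map.1 h1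
    obtain ⟨h4, h5⟩ := List.mem_filter.1 h3
    rw [mem_signAssignments] at h4
    have hσ : HeadSigns ρ σ := fun e he =>
      (atomHolds_headAtom ρ e).1 (h2 _ (List.mem_map.2 ⟨e, he, rfl⟩))
    have hD := ofSigns_correct hσ (by rwa [h4])
    obtain ⟨c, hc, htest⟩ := List.any_eq_true.1 h5
    obtain ⟨x, hx⟩ := hD.exists_point c hc
    exact ⟨x, (columnTest_iff ρ hx (by rwa [h4])).1 htest⟩
  · rintro ⟨x, hx⟩
    let σ : List (UPoly × SignType) := (closedFamily (conj.map fun a => ofCoeffPoly v a.2)).map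
      fun u => (u, SignType.sign (ev ρ (head u)))
    have h4 : σ.map Prod.fst = closedFamily (conj.map fun a => ofCoeffPoly v a.2) := by
      simp [σ, Function.comp_def]
    have hσ : HeadSigns ρ σ := by
      intro e he
      obtain ⟨u, _, rfl⟩ := List.mem_map.1 he
      rfl
    have hD := ofSigns_correct hσ (by rwa [h4])
    obtain ⟨c, hc, hcx⟩ := hD.exists_column x bot_le
    refine ⟨σ.map fun e => headAtom e, List.mem_map.2 ⟨σ, List.mem_filter.2
      ⟨mem_signAssignments.2 h4, List.any_eq_true.2 ⟨c, hc, ?_⟩⟩, rfl⟩, ?_⟩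
    · exact (columnTest_iff ρ hcx (by rwa [h4])).2 hx
    · intro a ha
      obtain ⟨e, he, rfl⟩ := List.mem_map.1 ha
      exact (atomHolds_headAtom ρ e).2 (hσ e he)

theorem sat_flatMap {β : Type*} (l : List β) (F : β → SignFormula) :
    Sat ρ (l.flatMap F) ↔ ∃ b ∈ l, Sat ρ (F b) := by
  simp only [Sat, List.mem_flatMap]
  constructor
  · rintro ⟨c, ⟨b, hb, hc⟩, h⟩
    exact ⟨b, hb, c, hc, h⟩
  · rintro ⟨b, hb, c, hc, h⟩
    exact ⟨c, ⟨b, hb, hc⟩, h⟩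

/-- Correctness of the elimination of one quantifier. -/
theorem sat_elim (v : List ℕ) (Φ : SignFormula) :
    Sat ρ (elim v Φ) ↔ ∃ x : ℝ, Sat (Function.update ρ v x) Φ := by
  rw [elim, sat_flatMap]
  simp only [sat_elimConj]
  constructor
  · rintro ⟨c, hc, x, h⟩
    exact ⟨x, c, hc, h⟩
  · rintro ⟨x, c, hc, h⟩
    exact ⟨c, hc, x, h⟩

theorem sat_elimAll (vs : List (List ℕ)) (Φ : SignFormula) :
    Sat ρ (elimAll vs Φ) ↔ ∃ ρ' : List ℕ → ℝ, (∀ w, w ∉ vs → ρ' w = ρ w) ∧ Sat ρ' Φ := by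
  induction vs generalizing ρ with
  | nil =>
    constructor
    · intro h
      exact ⟨ρ, fun _ _ => rfl, h⟩
    · rintro ⟨ρ', h, h'⟩
      obtain rfl : ρ' = ρ := funext fun w => h w (by simp)
      exact h'
  | cons v vs ih =>
    have h : elimAll (v :: vs) Φ = elim v (elimAll vs Φ) := rfl
    rw [h, sat_elim]
    simp only [ih]
    constructor
    · rintro ⟨x, ρ', h1, h2⟩
      refine ⟨ρ', fun w hw => ?_, h2⟩
      simp only [List.mem_cons, not_or] at hw
      rw [h1 w hw.2, Function.update_of_ne hw.1]
    · rintro ⟨ρ', h1, h2⟩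
      refine ⟨ρ' v, ρ', fun w hw => ?_, h2⟩
      by_cases hwv : w = v
      · subst hwv
        simp
      · rw [Function.update_of_ne hwv, h1 w (by simp [hwv, hw])]

theorem sat_conj (Φ Ψ : SignFormula) : Sat ρ (conj Φ Ψ) ↔ Sat ρ Φ ∧ Sat ρ Ψ := by
  rw [conj, sat_flatMap]
  simp only [Sat, List.mem_map]
  constructor
  · rintro ⟨c, hc, _, ⟨c', hc', rfl⟩, h⟩
    exact ⟨⟨c, hc, fun a ha => h a (by simp [ha])⟩, ⟨c', hc', fun a ha => h a (by simp [ha])⟩⟩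
  · rintro ⟨⟨c, hc, h⟩, ⟨c', hc', h'⟩⟩
    refine ⟨c, hc, _, ⟨c', hc', rfl⟩, fun a ha => ?_⟩
    rcases List.mem_append.1 ha with ha | ha
    · exact h a ha
    · exact h' a ha

theorem sat_negAtom (a : Bool × CoeffPoly) : Sat ρ (negAtom a) ↔ ¬ AtomHolds ρ a := by
  rcases a with ⟨b, p⟩
  cases b
  · simp [Sat, negAtom, AtomHolds, or_comm, lt_or_lt_iff_ne]
    exact ne_comm
  · simp [Sat, negAtom, AtomHolds, ← le_iff_lt_or_eq]

theorem sat_neg (Φ : SignFormula) : Sat ρ (neg Φ) ↔ ¬ Sat ρ Φ := by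
  induction Φ with
  | nil => simp [neg, Sat]
  | cons c Φ ih =>
    have h : neg (c :: Φ) = conj (c.flatMap fun a => negAtom a) (neg Φ) := rfl
    rw [h, sat_conj, ih, sat_flatMap]
    simp only [sat_negAtom]
    simp only [Sat, List.mem_cons, exists_eq_or_imp, not_or, not_forall,
      exists_prop]

end SignFormula

end VolumePolynomial

namespace VolumePolynomial

open CoeffPoly UPoly SignFormula

/-! ### Words and exponent vectors -/

/-- All lists of length `n` with entries in `A`. -/
def words {β : Type*} (A : List β) (n : ℕ) : List (List β) :=
  (fun L => L.flatMap fun l => A.map fun a => a :: l)^[n] [[]]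

/-- The lists of length `m` that describe the exponent vectors of degree `k`. -/
def exponentLists (m k : ℕ) : List (List ℕ) :=
  (words (List.range (k + 1)) m).filter fun l => decide (l.sum = k)

section Primrec

variable {α β : Type*} [Primcodable α] [Primcodable β]

@[fun_prop]
theorem words_primrec (A : α → List β) (n : α → ℕ) (hA : Primrec A) (hn : Primrec n) :
    Primrec (fun x => words (A x) (n x)) := by
  unfold words; fun_prop

@[fun_prop]
theorem exponentLists_primrec (m k : α → ℕ) (hm : Primrec m) (hk : Primrec k) :
    Primrec (fun x => exponentLists (m x) (k x)) := by
  unfold exponentLists; fun_prop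

end Primrec

theorem words_zero {β : Type*} (A : List β) : words A 0 = [[]] := rfl

theorem words_succ {β : Type*} (A : List β) (n : ℕ) :
    words A (n + 1) = (words A n).flatMap fun l => A.map fun a => a :: l := by
  rw [words, Function.iterate_succ_apply', words]

theorem mem_words {β : Type*} {A : List β} {n : ℕ} {l : List β} :
    l ∈ words A n ↔ l.length = n ∧ ∀ a ∈ l, a ∈ A := by
  induction n generalizing l with
  | zero =>
    rw [words_zero, List.mem_singleton]
    constructor
    · rintro rfl
      simp
    · rintro ⟨h, -⟩
      exact List.length_eq_zero_iff.1 h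
  | succ n ih =>
    rw [words_succ, List.mem_flatMap]
    constructor
    · rintro ⟨w, hw, h⟩
      obtain ⟨a, ha, rfl⟩ := List.mem_map.1 h
      rw [ih] at hw
      simp [hw.1, ha]
      exact hw.2
    · rintro ⟨h1, h2⟩
      rcases l with _ | ⟨a, l⟩
      · simp at h1
      · exact ⟨l, ih.2 ⟨by simpa using h1, fun b hb => h2 b (List.mem_cons_of_mem _ hb)⟩,
          List.mem_map.2 ⟨a, h2 a List.mem_cons_self, rfl⟩⟩

theorem nodup_words {β : Type*} {A : List β} (hA : A.Nodup) (n : ℕ) : (words A n).Nodup := by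
  induction n with
  | zero => simp [words_zero]
  | succ n ih =>
    rw [words_succ, List.nodup_flatMap]
    refine ⟨fun l _ => hA.map fun a b h => (List.cons.inj h).1, ih.imp fun {l l'} h => ?_⟩
    intro w hw hw'
    obtain ⟨a, _, rfl⟩ := List.mem_map.1 hw
    obtain ⟨b, _, h1⟩ := List.mem_map.1 hw'
    exact h (List.cons.inj h1).2.symm

theorem exponent_apply (m : ℕ) (l : List ℕ) (i : Fin m) : exponent m l i = l.getD i 0 := rfl

theorem exponent_ofFn {m : ℕ} (α : Fin m →₀ ℕ) : exponent m (List.ofFn α) = α := by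
  ext i
  simp [exponent_apply]

theorem exponent_injective {m : ℕ} {l l' : List ℕ} (h : l.length = m) (h' : l'.length = m)
    (he : exponent m l = exponent m l') : l = l' := by
  apply List.ext_getElem (by rw [h, h'])
  intro i h1 h2
  have := DFunLike.congr_fun he ⟨i, by omega⟩
  simpa [exponent_apply, h1, h2] using this

theorem degree_exponent {m : ℕ} {l : List ℕ} (h : l.length = m) :
    (exponent m l).degree = l.sum := by
  subst h
  rw [Finsupp.degree_eq_sum, ← Fin.sum_univ_getElem]
  simp [exponent_apply]

theorem mem_exponentLists {m k : ℕ} {l : List ℕ} :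
    l ∈ exponentLists m k ↔ l.length = m ∧ l.sum = k := by
  rw [exponentLists, List.mem_filter, mem_words, decide_eq_true_iff]
  constructor
  · rintro ⟨⟨h1, -⟩, h2⟩
    exact ⟨h1, h2⟩
  · rintro ⟨h1, h2⟩
    refine ⟨⟨h1, fun a ha => List.mem_range.2 ?_⟩, h2⟩
    have := List.single_le_sum (l := l) (by simp) a ha
    omega

theorem nodup_exponentLists (m k : ℕ) : (exponentLists m k).Nodup :=
  (nodup_words List.nodup_range m).filter _

/-- A sum over the exponent vectors of degree `k`, which may be taken over any finite set that
contains those at which the summand does not vanish. -/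
theorem sum_exponentLists {m k : ℕ} (f : (Fin m →₀ ℕ) → ℝ) (s : Finset (Fin m →₀ ℕ))
    (hs : ∀ α, α.degree ≠ k → α ∈ s → f α = 0) (hf : ∀ α, α.degree = k → α ∉ s → f α = 0) :
    ((exponentLists m k).map fun l => f (exponent m l)).sum = ∑ α ∈ s, f α := by
  classical
  have hnd : ((exponentLists m k).map fun l => exponent m l).Nodup := by
    refine List.Nodup.map_on ?_ (nodup_exponentLists m k)
    intro l hl l' hl' h
    exact exponent_injective (mem_exponentLists.1 hl).1 (mem_exponentLists.1 hl').1 h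
  have h1 : ((exponentLists m k).map fun l => f (exponent m l)).sum =
      ∑ α ∈ ((exponentLists m k).map fun l => exponent m l).toFinset, f α := by
    rw [List.sum_toFinset _ hnd, List.map_map]
    rfl
  have hmem : ∀ α : Fin m →₀ ℕ,
      α ∈ ((exponentLists m k).map fun l => exponent m l).toFinset ↔ α.degree = k := by
    intro α
    rw [List.mem_toFinset, List.mem_map]
    constructor
    · rintro ⟨l, hl, rfl⟩
      rw [degree_exponent (mem_exponentLists.1 hl).1, (mem_exponentLists.1 hl).2]
    · intro h
      refine ⟨List.ofFn α, mem_exponentLists.2 ⟨by simp, ?_⟩, exponent_ofFn α⟩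
      rw [← degree_exponent (m := m) (by simp), exponent_ofFn, h]
  rw [h1, ← Finset.sum_filter_of_ne (s := s) (p := fun α => α.degree = k)]
  · symm
    refine Finset.sum_subset (fun α hα => (hmem α).2 (Finset.mem_filter.1 hα).2) ?_
    intro α hα hα'
    rw [hmem] at hα
    exact hf α hα fun h => hα' (Finset.mem_filter.2 ⟨h, hα⟩)
  · intro α hα hne
    by_contra h
    exact hne (hs α h hα)

/-! ### The generic value of a derivative -/

theorem coeff_iterate_pderiv {m : ℕ} (i : Fin m) (n : ℕ) (V : MvPolynomial (Fin m) ℝ)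
    (β : Fin m →₀ ℕ) :
    ((MvPolynomial.pderiv i)^[n] V).coeff β =
      ((β i + n).descFactorial n : ℝ) * V.coeff (β + Finsupp.single i n) := by
  induction n generalizing β with
  | zero => simp
  | succ n ih =>
    rw [Function.iterate_succ_apply', MvPolynomial.coeff_pderiv, ih, Nat.descFactorial_succ]
    have h1 : (β + Finsupp.single i 1 : Fin m →₀ ℕ) i + n = β i + (n + 1) := by
      simp
      ring
    have h2 : β i + (n + 1) - n = β i + 1 := by omega
    have h3 : β + Finsupp.single i 1 + Finsupp.single i n = β + Finsupp.single i (n + 1) := by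
      rw [add_assoc, ← Finsupp.single_add, add_comm 1 n]
    rw [h1, h2, h3]
    push_cast
    ring

theorem coeff_monomialDeriv {m : ℕ} (α β : Fin m →₀ ℕ) (V : MvPolynomial (Fin m) ℝ) :
    (monomialDeriv α V).coeff β =
      (∏ i, ((β i + α i).descFactorial (α i) : ℝ)) * V.coeff (α + β) := by
  have key : ∀ (L : List (Fin m)), L.Nodup → ∀ β : Fin m →₀ ℕ,
      (L.foldr (fun i W => (MvPolynomial.pderiv i)^[α i] W) V).coeff β =
        (L.map fun i => ((β i + α i).descFactorial (α i) : ℝ)).prod *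
          V.coeff (β + (L.map fun i => Finsupp.single i (α i)).sum) := by
    intro L hL
    induction L with
    | nil => simp
    | cons i L ih =>
      intro β
      obtain ⟨hi, hL⟩ := List.nodup_cons.1 hL
      rw [List.foldr_cons, coeff_iterate_pderiv, ih hL, List.map_cons, List.prod_cons,
        List.map_cons, List.sum_cons, ← add_assoc, mul_assoc]
      congr 3
      refine List.map_congr_left fun j hj => ?_
      have hij : i ≠ j := fun h => hi (h ▸ hj)
      rw [Finsupp.add_apply, Finsupp.single_eq_of_ne' hij, add_zero]
  rw [monomialDeriv, key _ (List.nodup_finRange m), ← List.sum_toFinset _ (List.nodup_finRange m),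
    ← List.prod_toFinset _ (List.nodup_finRange m), List.toFinset_finRange,
    Finsupp.univ_sum_single, add_comm]

/-- The indeterminate that stands for the coordinate `xᵢ` of a point. Since exponent vectors have
length `m` and the coefficients of an operator are named by lists of length `m + 1`, it cannot be
confused with these. -/
def pointVar (m i : ℕ) : List ℕ := i :: List.replicate (m + 1) 0

/-- The number `(α + β)! / β!` for exponent vectors `α` and `β`. -/
def derivWeight (m : ℕ) (α β : List ℕ) : ℕ :=
  ((List.range m).map fun i => ((List.range (α.getD i 0)).map fun j =>
    β.getD i 0 + α.getD i 0 - j).prod).prod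

/-- The indeterminates in the term of `genericDerivative` that belongs to `α` and `β`. -/
def derivTerm (m : ℕ) (α β : List ℕ) : List (List ℕ) :=
  ((List.range m).map fun i => α.getD i 0 + β.getD i 0) :: (0 :: α) ::
    (List.range m).flatMap fun i => List.replicate (β.getD i 0) (pointVar m i)

/-- The expression `∑ d_α a_{α+β} (α+β)!/β! x^β`, over exponent vectors `α` of degree `k` and `β` of
degree `e`, which is the value at `x` of the form `D V`. The coefficients of `V` are named by their
exponent vectors, the coefficient `d_α` of `D` is named `0 :: α`. -/
def genericDerivative (m k e : ℕ) : CoeffPoly :=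
  (exponentLists m k).flatMap fun α => (exponentLists m e).map fun β =>
    ((derivWeight m α β : ℤ), derivTerm m α β)

/-- Some operator of degree `k` takes the form `V` of degree `k + e` to a form with a negative value
and without positive values. -/
def semidefiniteDerivative (m k e : ℕ) : SignFormula :=
  elimAll ((exponentLists m k).map fun α => 0 :: α)
    (SignFormula.conj
      (elimAll ((List.range m).map fun i => pointVar m i)
        [[(true, smul (-1) (genericDerivative m k e))]])
      (SignFormula.neg (elimAll ((List.range m).map fun i => pointVar m i)
        [[(true, genericDerivative m k e)]])))

/-- A quantifier-free formula for the condition that all nonzero derivatives of order less than `d`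
of a form of degree `d` in `m` variables change sign. -/
def changeSignFormula (m d : ℕ) : SignFormula :=
  SignFormula.neg ((List.range d).flatMap fun k => semidefiniteDerivative m k (d - k))

section Primrec

variable {α : Type*} [Primcodable α]

@[fun_prop]
theorem pointVar_primrec (m i : α → ℕ) (hm : Primrec m) (hi : Primrec i) :
    Primrec (fun x => pointVar (m x) (i x)) := by
  unfold pointVar; fun_prop

@[fun_prop]
theorem derivWeight_primrec (m : α → ℕ) (a b : α → List ℕ) (hm : Primrec m) (ha : Primrec a)
    (hb : Primrec b) : Primrec (fun x => derivWeight (m x) (a x) (b x)) := by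
  unfold derivWeight; fun_prop

@[fun_prop]
theorem derivTerm_primrec (m : α → ℕ) (a b : α → List ℕ) (hm : Primrec m) (ha : Primrec a)
    (hb : Primrec b) : Primrec (fun x => derivTerm (m x) (a x) (b x)) := by
  unfold derivTerm; fun_prop

@[fun_prop]
theorem genericDerivative_primrec (m k e : α → ℕ) (hm : Primrec m) (hk : Primrec k)
    (he : Primrec e) : Primrec (fun x => genericDerivative (m x) (k x) (e x)) := by
  unfold genericDerivative; fun_prop

@[fun_prop]
theorem semidefiniteDerivative_primrec (m k e : α → ℕ) (hm : Primrec m) (hk : Primrec k)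
    (he : Primrec e) : Primrec (fun x => semidefiniteDerivative (m x) (k x) (e x)) := by
  unfold semidefiniteDerivative; fun_prop

@[fun_prop]
theorem changeSignFormula_primrec (m d : α → ℕ) (hm : Primrec m) (hd : Primrec d) :
    Primrec (fun x => changeSignFormula (m x) (d x)) := by
  unfold changeSignFormula; fun_prop

end Primrec

theorem ev_flatMap {β : Type*} (ρ : List ℕ → ℝ) (l : List β) (F : β → CoeffPoly) :
    ev ρ (l.flatMap F) = (l.map fun b => ev ρ (F b)).sum := by
  induction l with
  | nil => simp
  | cons b l ih => simp [ih]

@[to_additive]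
theorem list_prod_map_range {M : Type*} [CommMonoid M] (m : ℕ) (f : ℕ → M) :
    ((List.range m).map f).prod = ∏ i : Fin m, f i := by
  rw [← List.prod_ofFn]
  congr 1
  apply List.ext_getElem <;> simp

theorem ev_genericDerivative_term {m : ℕ} (ρ : List ℕ → ℝ) (α β : List ℕ) :
    ev ρ [((derivWeight m α β : ℤ), derivTerm m α β)] =
    (∏ i, ((exponent m β i + exponent m α i).descFactorial (exponent m α i) : ℝ)) *
      (ρ ((List.range m).map fun i => α.getD i 0 + β.getD i 0) * (ρ (0 :: α) *
        ∏ i : Fin m, ρ (pointVar m i) ^ exponent m β i)) := by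
  have h1 : derivWeight m α β =
      ∏ i, (exponent m β i + exponent m α i).descFactorial (exponent m α i) := by
    rw [derivWeight, list_prod_map_range]
    refine Finset.prod_congr rfl fun i _ => ?_
    rw [Nat.descFactorial_eq_prod_range, list_prod_map_range, Finset.prod_range]
    rfl
  have h2 : (((List.range m).flatMap fun i =>
      List.replicate (β.getD i 0) (pointVar m i)).map ρ).prod =
        ∏ i : Fin m, ρ (pointVar m i) ^ exponent m β i := by
    rw [List.map_flatMap, List.flatMap, List.prod_flatten, List.map_map, list_prod_map_range]
    refine Finset.prod_congr rfl fun i _ => ?_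
    simp [exponent_apply]
  rw [h1, derivTerm, ev_cons, ev_nil, add_zero, List.map_cons, List.map_cons, List.prod_cons,
    List.prod_cons, h2]
  push_cast
  rfl

theorem exponent_add_lists {m : ℕ} (α β : List ℕ) :
    exponent m ((List.range m).map fun i => α.getD i 0 + β.getD i 0) =
      exponent m α + exponent m β := by
  ext i
  simp [exponent_apply]

theorem ev_genericDerivative {m k e : ℕ} {V D : MvPolynomial (Fin m) ℝ}
    (hV : V.IsHomogeneous (k + e)) (hD : D.IsHomogeneous k) {ρ : List ℕ → ℝ}
    (hρV : ∀ l : List ℕ, l.length = m → ρ l = V.coeff (exponent m l))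
    (hρD : ∀ α ∈ exponentLists m k, ρ (0 :: α) = D.coeff (exponent m α)) :
    ev ρ (genericDerivative m k e) =
      MvPolynomial.eval (fun i : Fin m => ρ (pointVar m i)) (applyDiffOp D V) := by
  have hderiv : ∀ α : Fin m →₀ ℕ, α.degree = k → ∀ x : Fin m → ℝ,
      MvPolynomial.eval x (monomialDeriv α V) =
      ((exponentLists m e).map fun l => (∏ i, ((exponent m l i + α i).descFactorial (α i) : ℝ)) *
        V.coeff (α + exponent m l) * ∏ i, x i ^ exponent m l i).sum := by
    intro α hα x
    rw [sum_exponentLists (fun β => (∏ i, ((β i + α i).descFactorial (α i) : ℝ)) *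
        V.coeff (α + β) * ∏ i, x i ^ β i) (monomialDeriv α V).support]
    · rw [MvPolynomial.eval_eq']
      refine Finset.sum_congr rfl fun β _ => ?_
      rw [coeff_monomialDeriv]
    · intro β hβ _
      rw [hV.coeff_eq_zero, mul_zero, zero_mul]
      rw [map_add, hα]
      omega
    · intro β _ hβ
      rw [← coeff_monomialDeriv, MvPolynomial.notMem_support_iff.1 hβ, zero_mul]
  have hsum := sum_exponentLists (m := m) (k := k) (fun α => D.coeff α *
    MvPolynomial.eval (fun i : Fin m => ρ (pointVar m i)) (monomialDeriv α V)) D.support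
    (fun α hα _ => by rw [hD.coeff_eq_zero hα, zero_mul])
    (fun α _ hα => by rw [MvPolynomial.notMem_support_iff.1 hα, zero_mul])
  rw [applyDiffOp, map_sum]
  simp only [MvPolynomial.smul_eval]
  rw [← hsum, genericDerivative, ev_flatMap]
  congr 1
  refine List.map_congr_left fun α hα => ?_
  obtain ⟨hαm, hαk⟩ := mem_exponentLists.1 hα
  rw [hderiv _ (by rw [degree_exponent hαm, hαk])]
  rw [← List.flatMap_singleton' ((exponentLists m e).map _), List.flatMap_map, ev_flatMap,
    ← List.sum_map_mul_left]
  congr 1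
  refine List.map_congr_left fun β hβ => ?_
  rw [ev_genericDerivative_term, hρV _ (by simp), hρD α hα, exponent_add_lists]
  ring

theorem applyDiffOp_neg {m : ℕ} (D V : MvPolynomial (Fin m) ℝ) :
    applyDiffOp (-D) V = -applyDiffOp D V := by
  simp [applyDiffOp, MvPolynomial.support_neg]

/-- Since `D` may be replaced by `-D`, the sign condition says that no nonzero derivative is
negative semidefinite. -/
theorem derivativesChangeSign_iff {m d : ℕ} {V : MvPolynomial (Fin m) ℝ} :
    DerivativesChangeSign d V ↔ ¬ ∃ k < d, ∃ D : MvPolynomial (Fin m) ℝ, D.IsHomogeneous k ∧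
      (∃ x : Fin m → ℝ, MvPolynomial.eval x (applyDiffOp D V) < 0) ∧
        ¬ ∃ x : Fin m → ℝ, 0 < MvPolynomial.eval x (applyDiffOp D V) := by
  constructor
  · rintro h ⟨k, hk, D, hD, ⟨x, hx⟩, h2⟩
    refine h2 (h k hk D hD ?_).1
    intro h0
    rw [h0] at hx
    simp at hx
  · intro h
    have key : ∀ k < d, ∀ D : MvPolynomial (Fin m) ℝ, D.IsHomogeneous k → applyDiffOp D V ≠ 0 →
        ∃ x : Fin m → ℝ, 0 < MvPolynomial.eval x (applyDiffOp D V) := by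
      intro k hk D hD h0
      by_contra hpos
      refine h ⟨k, hk, D, hD, ?_, hpos⟩
      by_contra hneg
      push Not at hpos hneg
      exact h0 (MvPolynomial.funext fun x => by
        rw [map_zero]
        exact le_antisymm (hpos x) (hneg x))
    intro k hk D hD h0
    refine ⟨key k hk D hD h0, ?_⟩
    obtain ⟨y, hy⟩ := key k hk (-D) hD.neg (by rw [applyDiffOp_neg]; exact neg_ne_zero.2 h0)
    rw [applyDiffOp_neg, map_neg] at hy
    exact ⟨y, by linarith⟩

/-- Satisfiability after elimination of the coordinates of a point, for an expression `p` whose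
value is a function `f` of these coordinates when the other indeterminates keep their values. -/
theorem sat_exists_point {m : ℕ} (ρ : List ℕ → ℝ) (p : CoeffPoly) (f : (Fin m → ℝ) → ℝ)
    (hf : ∀ ρ' : List ℕ → ℝ, (∀ w : List ℕ, w.length < m + 2 → ρ' w = ρ w) →
      ev ρ' p = f fun i => ρ' (pointVar m i)) :
    Sat ρ (elimAll ((List.range m).map fun i => pointVar m i) [[(true, p)]]) ↔
      ∃ x : Fin m → ℝ, 0 < f x := by
  have hlen : ∀ w : List ℕ, w.length < m + 2 →
      w ∉ (List.range m).map fun i => pointVar m i := by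
    intro w hw h
    obtain ⟨i, _, rfl⟩ := List.mem_map.1 h
    simp [pointVar] at hw
  rw [sat_elimAll]
  constructor
  · rintro ⟨ρ', h1, h2⟩
    refine ⟨fun i => ρ' (pointVar m i), ?_⟩
    rw [← hf ρ' fun w hw => h1 w (hlen w hw)]
    simpa [Sat, AtomHolds] using h2
  · rintro ⟨x, hx⟩
    let ρ' : List ℕ → ℝ := fun w => if w ∈ (List.range m).map (fun i => pointVar m i) then
      (if h : w.headI < m then x ⟨w.headI, h⟩ else 0) else ρ w
    have h1 : ∀ w, w ∉ (List.range m).map (fun i => pointVar m i) → ρ' w = ρ w := fun w hw =>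
      if_neg hw
    have h2 : (fun i : Fin m => ρ' (pointVar m i)) = x := by
      funext i
      have hi : pointVar m i ∈ (List.range m).map (fun i => pointVar m i) :=
        List.mem_map.2 ⟨i, List.mem_range.2 i.2, rfl⟩
      simp only [ρ', if_pos hi]
      simp [pointVar]
    refine ⟨ρ', h1, ?_⟩
    have := hf ρ' fun w hw => h1 w (hlen w hw)
    rw [h2] at this
    simpa [Sat, AtomHolds, this] using hx

theorem sat_semidefiniteDerivative {m k e : ℕ} {V : MvPolynomial (Fin m) ℝ}
    (hV : V.IsHomogeneous (k + e)) :
    Sat (fun l => V.coeff (exponent m l)) (semidefiniteDerivative m k e) ↔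
      ∃ D : MvPolynomial (Fin m) ℝ, D.IsHomogeneous k ∧
      (∃ x : Fin m → ℝ, MvPolynomial.eval x (applyDiffOp D V) < 0) ∧
        ¬ ∃ x : Fin m → ℝ, 0 < MvPolynomial.eval x (applyDiffOp D V) := by
  classical
  have key : ∀ (ρ : List ℕ → ℝ) (D : MvPolynomial (Fin m) ℝ), D.IsHomogeneous k →
      (∀ l : List ℕ, l.length = m → ρ l = V.coeff (exponent m l)) →
      (∀ α ∈ exponentLists m k, ρ (0 :: α) = D.coeff (exponent m α)) →
      (Sat ρ (SignFormula.conj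
        (elimAll ((List.range m).map fun i => pointVar m i)
          [[(true, smul (-1) (genericDerivative m k e))]])
        (SignFormula.neg (elimAll ((List.range m).map fun i => pointVar m i)
          [[(true, genericDerivative m k e)]]))) ↔
      (∃ x : Fin m → ℝ, MvPolynomial.eval x (applyDiffOp D V) < 0) ∧
        ¬ ∃ x : Fin m → ℝ, 0 < MvPolynomial.eval x (applyDiffOp D V)) := by
    intro ρ D hD h1 h2
    have h3 : ∀ ρ' : List ℕ → ℝ, (∀ w : List ℕ, w.length < m + 2 → ρ' w = ρ w) →
        ev ρ' (genericDerivative m k e) =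
          MvPolynomial.eval (fun i : Fin m => ρ' (pointVar m i)) (applyDiffOp D V) := by
      intro ρ' h
      refine ev_genericDerivative hV hD (fun l hl => ?_) (fun α hα => ?_)
      · rw [h l (by omega), h1 l hl]
      · rw [h _ ?_, h2 α hα]
        rw [List.length_cons, (mem_exponentLists.1 hα).1]
        omega
    rw [sat_conj, sat_neg,
      sat_exists_point ρ _ (fun x => MvPolynomial.eval x (applyDiffOp D V)) h3,
      sat_exists_point ρ _ (fun x => -MvPolynomial.eval x (applyDiffOp D V))]
    · simp only [Left.neg_pos_iff]
    · intro ρ' h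
      rw [ev_smul, h3 ρ' h]
      push_cast
      ring
  rw [semidefiniteDerivative, sat_elimAll]
  have hlen : ∀ w : List ℕ, w.length = m → w ∉ (exponentLists m k).map fun α => 0 :: α := by
    intro w hw h
    obtain ⟨α, hα, rfl⟩ := List.mem_map.1 h
    rw [List.length_cons, (mem_exponentLists.1 hα).1] at hw
    omega
  constructor
  · rintro ⟨ρ, h1, h2⟩
    let D : MvPolynomial (Fin m) ℝ := ∑ α ∈ (exponentLists m k).toFinset,
      MvPolynomial.monomial (exponent m α) (ρ (0 :: α))
    have hD : D.IsHomogeneous k := by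
      refine MvPolynomial.IsHomogeneous.sum _ _ _ fun α hα => ?_
      rw [List.mem_toFinset, mem_exponentLists] at hα
      exact MvPolynomial.isHomogeneous_monomial _ (by rw [degree_exponent hα.1, hα.2])
    refine ⟨D, hD, (key ρ D hD (fun l hl => h1 l (hlen l hl)) fun α hα => ?_).1 h2⟩
    simp only [D, MvPolynomial.coeff_sum, MvPolynomial.coeff_monomial]
    rw [Finset.sum_eq_single α, if_pos rfl]
    · intro β hβ hne
      rw [List.mem_toFinset] at hβ
      refine if_neg fun h => hne ?_
      exact exponent_injective (mem_exponentLists.1 hβ).1 (mem_exponentLists.1 hα).1 h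
    · intro h
      exact absurd (List.mem_toFinset.2 hα) h
  · rintro ⟨D, hD, h⟩
    let ρ : List ℕ → ℝ := fun w => if w ∈ (exponentLists m k).map (fun α => 0 :: α) then
      D.coeff (exponent m w.tail) else V.coeff (exponent m w)
    have h1 : ∀ w, w ∉ (exponentLists m k).map (fun α => 0 :: α) →
        ρ w = V.coeff (exponent m w) := fun w hw => if_neg hw
    refine ⟨ρ, h1, (key ρ D hD (fun l hl => h1 l (hlen l hl)) fun α hα => ?_).2 h⟩
    exact if_pos (List.mem_map.2 ⟨α, hα, rfl⟩)

theorem holds_changeSignFormula {m d : ℕ} {V : MvPolynomial (Fin m) ℝ} (hV : V.IsHomogeneous d) :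
    (changeSignFormula m d).Holds V ↔ DerivativesChangeSign d V := by
  have h : (changeSignFormula m d).Holds V ↔
      Sat (fun l => V.coeff (exponent m l)) (changeSignFormula m d) := Iff.rfl
  rw [h, changeSignFormula, sat_neg, sat_flatMap, derivativesChangeSign_iff]
  refine not_congr (exists_congr fun k => ?_)
  rw [List.mem_range]
  refine and_congr_right fun hk => ?_
  exact sat_semidefiniteDerivative (by rwa [Nat.add_sub_cancel' hk.le])

end VolumePolynomial

namespace VolumePolynomial

open CoeffPoly SignFormula

/-! ### Forms with rational coefficients -/

theorem applyDiffOp_smul {m : ℕ} (r : ℝ) (D V : MvPolynomial (Fin m) ℝ) :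
    applyDiffOp D (r • V) = r • applyDiffOp D V := by
  rw [applyDiffOp, applyDiffOp, Finset.smul_sum]
  refine Finset.sum_congr rfl fun α _ => ?_
  ext β
  simp only [MvPolynomial.coeff_smul, coeff_monomialDeriv, smul_eq_mul]
  ring

theorem derivativesChangeSign_smul {m d : ℕ} {r : ℝ} (hr : 0 < r) (V : MvPolynomial (Fin m) ℝ) :
    DerivativesChangeSign d (r • V) ↔ DerivativesChangeSign d V := by
  have hneg : ∀ y : ℝ, r * y < 0 ↔ y < 0 := fun y => by
    rw [mul_neg_iff]
    simp [hr, hr.le]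
  simp only [derivativesChangeSign_iff, applyDiffOp_smul, MvPolynomial.smul_eval,
    hneg, mul_pos_iff_of_pos_left hr]

namespace PolyCode

/-- A common denominator of the coefficients. -/
def denominator (c : PolyCode) : ℕ := (c.map fun t => t.2.2 + 1).prod

/-- The coefficient at the exponent vector `l`, multiplied by the common denominator. -/
def intCoeff (m : ℕ) (c : PolyCode) (l : List ℕ) : ℤ :=
  (c.map fun t => if (List.range m).map (fun i => t.1.getD i 0) =
      (List.range m).map (fun i => l.getD i 0) then
    t.2.1 * ((denominator c / (t.2.2 + 1) : ℕ) : ℤ) else 0).sum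

/-- The value of a polynomial expression in the coefficients multiplied by the common
denominator. -/
def intValue (m : ℕ) (c : PolyCode) (p : CoeffPoly) : ℤ :=
  (p.map fun t => t.1 * (t.2.map fun l => intCoeff m c l).prod).sum

/-- The truth of a formula for the coefficients multiplied by the common denominator. -/
def test (m : ℕ) (c : PolyCode) (Φ : SignFormula) : Bool :=
  Φ.any fun conj => conj.all fun a =>
    if a.1 = true then decide (0 < intValue m c a.2) else decide (intValue m c a.2 = 0)

/-- A decision procedure for the sign condition. -/
def decideChangeSign (m d : ℕ) (c : PolyCode) : Bool := test m c (changeSignFormula m d)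

section Primrec

variable {α : Type*} [Primcodable α]

@[fun_prop]
theorem nat_div_primrec (f g : α → ℕ) (hf : Primrec f) (hg : Primrec g) :
    Primrec (fun x => f x / g x) := Primrec.nat_div.comp hf hg

@[fun_prop]
theorem denominator_primrec (c : α → PolyCode) (hc : Primrec c) :
    Primrec (fun x => denominator (c x)) := by
  unfold denominator; fun_prop

@[fun_prop]
theorem intCoeff_primrec (m : α → ℕ) (c : α → PolyCode) (l : α → List ℕ) (hm : Primrec m)
    (hc : Primrec c) (hl : Primrec l) : Primrec (fun x => intCoeff (m x) (c x) (l x)) := by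
  unfold intCoeff; fun_prop

@[fun_prop]
theorem intValue_primrec (m : α → ℕ) (c : α → PolyCode) (p : α → CoeffPoly) (hm : Primrec m)
    (hc : Primrec c) (hp : Primrec p) : Primrec (fun x => intValue (m x) (c x) (p x)) := by
  unfold intValue; fun_prop

@[fun_prop]
theorem test_primrec (m : α → ℕ) (c : α → PolyCode) (Φ : α → SignFormula) (hm : Primrec m)
    (hc : Primrec c) (hΦ : Primrec Φ) : Primrec (fun x => test (m x) (c x) (Φ x)) := by
  unfold test; fun_prop

@[fun_prop]
theorem decideChangeSign_primrec (m d : α → ℕ) (c : α → PolyCode) (hm : Primrec m)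
    (hd : Primrec d) (hc : Primrec c) :
    Primrec (fun x => decideChangeSign (m x) (d x) (c x)) := by
  unfold decideChangeSign; fun_prop

end Primrec

theorem denominator_pos (c : PolyCode) : 0 < denominator c :=
  List.prod_pos fun a ha => by
    obtain ⟨t, _, rfl⟩ := List.mem_map.1 ha
    exact Nat.succ_pos _

theorem exponent_eq_iff {m : ℕ} {l l' : List ℕ} : exponent m l = exponent m l' ↔
    (List.range m).map (fun i => l.getD i 0) = (List.range m).map (fun i => l'.getD i 0) := by
  rw [List.map_inj_left, DFunLike.ext_iff]
  constructor
  · intro h i hi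
    exact h ⟨i, List.mem_range.1 hi⟩
  · intro h i
    exact h i (List.mem_range.2 i.2)

theorem intCoeff_eq (m : ℕ) (c : PolyCode) (l : List ℕ) :
    (intCoeff m c l : ℝ) = (denominator c : ℝ) * (c.toPoly m).coeff (exponent m l) := by
  have key : ∀ c' : PolyCode, (∀ t ∈ c', t.2.2 + 1 ∣ denominator c) →
      (((c'.map fun t => if (List.range m).map (fun i => t.1.getD i 0) =
      (List.range m).map (fun i => l.getD i 0) then
      t.2.1 * ((denominator c / (t.2.2 + 1) : ℕ) : ℤ) else 0).sum : ℤ) : ℝ) =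
      (denominator c : ℝ) * (c'.toPoly m).coeff (exponent m l) := by
    intro c' h
    induction c' with
    | nil => simp [PolyCode.toPoly]
    | cons t c' ih =>
      have h1 : PolyCode.toPoly m (t :: c') =
        MvPolynomial.monomial (exponent m t.1) ((t.2.1 : ℝ) / ((t.2.2 : ℝ) + 1)) +
          PolyCode.toPoly m c' := by simp [PolyCode.toPoly]
      rw [h1, MvPolynomial.coeff_add, mul_add, ← ih fun s hs => h s (List.mem_cons_of_mem _ hs),
        List.map_cons, List.sum_cons, Int.cast_add, MvPolynomial.coeff_monomial]
      congr 1
      simp only [exponent_eq_iff]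
      split_ifs with h2
      · have h3 := h t List.mem_cons_self
        have h4 : (t.2.2 : ℝ) + 1 ≠ 0 := by positivity
        rw [Int.cast_mul, Int.cast_natCast, Nat.cast_div h3 (by exact_mod_cast h4)]
        push_cast
        field_simp
      · simp
  exact key c fun t ht => List.dvd_prod (List.mem_map.2 ⟨t, ht, rfl⟩)

theorem intValue_eq (m : ℕ) (c : PolyCode) (p : CoeffPoly) :
    (intValue m c p : ℝ) = CoeffPoly.value ((denominator c : ℝ) • c.toPoly m) p := by
  induction p with
  | nil => simp [intValue, CoeffPoly.value]
  | cons t p ih =>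
    have h1 : intValue m c (t :: p) =
      t.1 * (t.2.map fun l => intCoeff m c l).prod + intValue m c p := by simp [intValue]
    have h2 : CoeffPoly.value ((denominator c : ℝ) • c.toPoly m) (t :: p) =
      (t.1 : ℝ) * (t.2.map fun l =>
        ((denominator c : ℝ) • c.toPoly m).coeff (exponent m l)).prod +
        CoeffPoly.value ((denominator c : ℝ) • c.toPoly m) p := by simp [CoeffPoly.value]
    rw [h1, h2, ← ih]
    push_cast
    congr 2
    rw [List.map_map]
    congr 1
    refine List.map_congr_left fun l _ => ?_
    rw [Function.comp_apply, intCoeff_eq, MvPolynomial.coeff_smul, smul_eq_mul]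

theorem test_iff (m : ℕ) (c : PolyCode) (Φ : SignFormula) :
    test m c Φ = true ↔ Φ.Holds ((denominator c : ℝ) • c.toPoly m) := by
  rw [test, List.any_eq_true, SignFormula.Holds]
  refine exists_congr fun conj => and_congr_right fun _ => ?_
  rw [List.all_eq_true]
  refine forall₂_congr fun a _ => ?_
  rw [← intValue_eq]
  rcases a with ⟨b, p⟩
  cases b <;> simp

theorem decideChangeSign_iff {m d : ℕ} {c : PolyCode} (hc : (c.toPoly m).IsHomogeneous d) :
    decideChangeSign m d c = true ↔ DerivativesChangeSign d (c.toPoly m) := by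
  rw [decideChangeSign, test_iff, holds_changeSignFormula,
    derivativesChangeSign_smul (by exact_mod_cast denominator_pos c)]
  rw [MvPolynomial.smul_eq_C_mul]
  simpa using (MvPolynomial.isHomogeneous_C (Fin m) (denominator c : ℝ)).mul hc

end PolyCode

end VolumePolynomial

namespace VolumePolynomial

open CoeffPoly SignFormula

/-! ### Determinants of lists of columns -/

/-- The sign of a permutation given by the list of its values (zero, if a value is repeated). -/
def wordSign (r : List ℕ) : ℤ :=
  ((List.range r.length).map fun j => ((List.range r.length).map fun i =>
    if i < j then ((r.getD j 0 : ℤ) - (r.getD i 0 : ℤ)).sign else 1).prod).prod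

/-- The determinant of the columns with indices `u` of the matrix with rows `Λ`, by the Leibniz
formula. -/
def columnDet (Λ : List (List ℤ)) (u : List ℕ) : ℤ :=
  ((words (List.range u.length) u.length).map fun r =>
    wordSign r * ((List.range u.length).map fun k =>
      (Λ.getD (r.getD k 0) []).getD (u.getD k 0) 0).prod).sum

section Primrec

variable {α : Type*} [Primcodable α]

@[fun_prop]
theorem wordSign_primrec (r : α → List ℕ) (hr : Primrec r) :
    Primrec (fun x => wordSign (r x)) := by
  unfold wordSign; fun_prop

@[fun_prop]
theorem columnDet_primrec (Λ : α → List (List ℤ)) (u : α → List ℕ) (hΛ : Primrec Λ)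
    (hu : Primrec u) : Primrec (fun x => columnDet (Λ x) (u x)) := by
  unfold columnDet; fun_prop

end Primrec

theorem sum_words {M : Type*} [AddCommMonoid M] (m n : ℕ) (f : List ℕ → M) :
    ((words (List.range m) n).map f).sum =
      ∑ w : Fin n → Fin m, f (List.ofFn fun k => (w k : ℕ)) := by
  classical
  have hinj : Function.Injective fun w : Fin n → Fin m => List.ofFn fun k => (w k : ℕ) := by
    intro w w' h
    have := List.ofFn_injective h
    funext k
    exact Fin.ext (congrFun this k)
  rw [← List.sum_toFinset _ (nodup_words List.nodup_range n),
    ← Finset.sum_image (s := Finset.univ)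
      (g := fun w : Fin n → Fin m => List.ofFn fun k => (w k : ℕ))
      (f := f) (fun w _ w' _ h => hinj h)]
  refine Finset.sum_congr ?_ fun _ _ => rfl
  ext l
  rw [List.mem_toFinset, mem_words, Finset.mem_image]
  constructor
  · rintro ⟨rfl, h⟩
    refine ⟨fun k => ⟨l[k], List.mem_range.1 (h _ (List.getElem_mem _))⟩, Finset.mem_univ _, ?_⟩
    exact List.ofFn_getElem
  · rintro ⟨w, -, rfl⟩
    refine ⟨by simp, fun a ha => ?_⟩
    obtain ⟨k, rfl⟩ := List.mem_ofFn.1 ha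
    exact List.mem_range.2 (w k).2

theorem wordSign_ofFn {n : ℕ} (r : Fin n → ℕ) :
    wordSign (List.ofFn r) = ∏ j, ∏ i ∈ Finset.Iio j, ((r j : ℤ) - (r i : ℤ)).sign := by
  rw [wordSign, List.length_ofFn, list_prod_map_range]
  refine Finset.prod_congr rfl fun j _ => ?_
  rw [list_prod_map_range]
  have h : ∀ i : Fin n, (if (i : ℕ) < (j : ℕ) then
      (((List.ofFn r).getD j 0 : ℤ) - ((List.ofFn r).getD i 0 : ℤ)).sign else 1) =
      if i < j then ((r j : ℤ) - (r i : ℤ)).sign else 1 := by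
    intro i
    simp
  rw [Finset.prod_congr rfl fun i _ => h i, ← Finset.prod_filter]
  refine Finset.prod_congr ?_ fun _ _ => rfl
  ext i
  simp

theorem wordSign_perm {n : ℕ} (σ : Equiv.Perm (Fin n)) :
    wordSign (List.ofFn fun k => (σ k : ℕ)) = (Equiv.Perm.sign σ : ℤ) := by
  rw [wordSign_ofFn]
  have h := σ.prod_Iio_comp_eq_sign_mul_prod (R := ℤ)
    (f := fun i j => (((j : ℕ) : ℤ) - ((i : ℕ) : ℤ)).sign) (fun i j => by
      rw [← Int.sign_neg, neg_sub])
  rw [h]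
  have h1 : ∏ j : Fin n, ∏ i ∈ Finset.Iio j, (((j : ℕ) : ℤ) - ((i : ℕ) : ℤ)).sign = 1 := by
    refine Finset.prod_eq_one fun j _ => Finset.prod_eq_one fun i hi => ?_
    have : (i : ℕ) < (j : ℕ) := Fin.lt_def.1 (Finset.mem_Iio.1 hi)
    exact Int.sign_eq_one_of_pos (by omega)
  rw [h1]
  simp

theorem wordSign_of_not_injective {n : ℕ} (r : Fin n → Fin n) (hr : ¬ Function.Injective r) :
    wordSign (List.ofFn fun k => (r k : ℕ)) = 0 := by
  rw [wordSign_ofFn]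
  simp only [Function.Injective, not_forall] at hr
  obtain ⟨a, b, h, hne⟩ := hr
  rcases lt_or_gt_of_ne hne with hab | hab
  · refine Finset.prod_eq_zero (Finset.mem_univ b) (Finset.prod_eq_zero (Finset.mem_Iio.2 hab) ?_)
    simp [h]
  · refine Finset.prod_eq_zero (Finset.mem_univ a) (Finset.prod_eq_zero (Finset.mem_Iio.2 hab) ?_)
    simp [h]

/-- In the Leibniz formula the sum over permutations may be taken over all self-maps, as the sign of
a word with a repeated letter is zero. -/
theorem columnDet_eq {n m : ℕ} (Λ : Matrix (Fin n) (Fin m) ℤ) (u : Fin n → Fin m) :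
    columnDet (List.ofFn fun i => List.ofFn fun j => Λ i j) (List.ofFn fun k => (u k : ℕ)) =
      (Λ.submatrix id u).det := by
  rw [columnDet, List.length_ofFn, sum_words, Matrix.det_apply']
  symm
  refine Fintype.sum_of_injective (fun σ : Equiv.Perm (Fin n) => (σ : Fin n → Fin n))
    DFunLike.coe_injective _ _ (fun r hr => ?_) (fun σ => ?_)
  · rw [wordSign_of_not_injective, zero_mul]
    intro hinj
    exact hr ⟨Equiv.ofBijective r (Finite.injective_iff_bijective.1 hinj), rfl⟩
  · simp only [wordSign_perm]
    rw [list_prod_map_range]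
    congr 1
    refine Finset.prod_congr rfl fun k _ => ?_
    simp

/-! ### Faces and vertices of a simple polytope -/

namespace CharacteristicPair

variable {n m : ℕ} (Q : CharacteristicPair n m)

theorem isExtreme_face (S : Finset (Fin m)) :
    IsExtreme ℝ Q.polytope (Q.polytope ∩ ⋂ i ∈ S, Q.facetSet i) := by
  refine ⟨Set.inter_subset_left, fun x hx y hy z hz hzxy => ⟨hx, ?_⟩⟩
  refine Set.mem_iInter₂.2 fun i hi => ⟨hx, ?_⟩
  have hz0 := (Set.mem_iInter₂.1 hz.2 i hi).2
  obtain ⟨a, b, ha, hb, hab, rfl⟩ := hzxy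
  have hx0 : 0 ≤ Q.normal i ⬝ᵥ x + Q.offset i := hx i
  have hy0 : 0 ≤ Q.normal i ⬝ᵥ y + Q.offset i := hy i
  have h : a * (Q.normal i ⬝ᵥ x + Q.offset i) + b * (Q.normal i ⬝ᵥ y + Q.offset i) = 0 := by
    rw [dotProduct_add, dotProduct_smul, dotProduct_smul, smul_eq_mul, smul_eq_mul] at hz0
    linear_combination hz0 + Q.offset i * hab
  nlinarith [mul_nonneg hb.le hy0, mul_nonneg ha.le hx0]

/-- Every nonempty face contains a vertex. -/
theorem exists_vertex_of_face (S : Finset (Fin m))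
    (h : (Q.polytope ∩ ⋂ i ∈ S, Q.facetSet i).Nonempty) :
    ∃ x ∈ Q.polytope.extremePoints ℝ, ∀ i ∈ S, i ∈ activeSet Q.normal Q.offset x := by
  have hcl : IsClosed (Q.polytope ∩ ⋂ i ∈ S, Q.facetSet i) := by
    have hP : IsClosed Q.polytope := by
      have : Q.polytope = ⋂ i, {x | 0 ≤ Q.normal i ⬝ᵥ x + Q.offset i} := by
        ext x
        simp [polytope, polyhedron]
      rw [this]
      exact isClosed_iInter fun i => isClosed_le continuous_const (by fun_prop)
    refine hP.inter (isClosed_biInter fun i _ => ?_)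
    have : Q.facetSet i = Q.polytope ∩ {x | Q.normal i ⬝ᵥ x + Q.offset i = 0} := rfl
    rw [this]
    exact hP.inter (isClosed_eq (by fun_prop) continuous_const)
  have hbd : Bornology.IsBounded (Q.polytope ∩ ⋂ i ∈ S, Q.facetSet i) :=
    Q.bounded.subset Set.inter_subset_left
  obtain ⟨x, hx⟩ := (Metric.isCompact_of_isClosed_isBounded hcl hbd).extremePoints_nonempty h
  refine ⟨x, (Q.isExtreme_face S).extremePoints_subset_extremePoints hx, fun i hi => ?_⟩
  exact (Set.mem_iInter₂.1 hx.1.2 i hi).2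

/-- The normal vectors at a vertex are linearly independent: otherwise the vertex could be moved
in a direction that is orthogonal to all of them. -/
theorem normalDet_ne_zero {I : Fin n → Fin m} (hI : Q.IsVertexTuple I) : Q.normalDet I ≠ 0 := by
  intro h0
  obtain ⟨x, hx, hrange⟩ := hI
  obtain ⟨v, hv, hMv⟩ := Matrix.exists_mulVec_eq_zero_iff.2 h0
  have hact : ∀ i ∈ activeSet Q.normal Q.offset x, Q.normal i ⬝ᵥ v = 0 := by
    intro i hi
    rw [← hrange] at hi
    obtain ⟨k, rfl⟩ := hi
    exact congrFun hMv k
  have hev : ∀ᶠ t : ℝ in nhds 0, ∀ i, 0 ≤ Q.normal i ⬝ᵥ (x + t • v) + Q.offset i := by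
    rw [Filter.eventually_all]
    intro i
    by_cases hi : i ∈ activeSet Q.normal Q.offset x
    · refine Filter.Eventually.of_forall fun t => ?_
      rw [dotProduct_add, dotProduct_smul, hact i hi, smul_zero, add_zero]
      exact hx.1 i
    · have hpos : 0 < Q.normal i ⬝ᵥ (x + (0 : ℝ) • v) + Q.offset i := by
        rw [zero_smul, add_zero]
        exact lt_of_le_of_ne (hx.1 i) (Ne.symm hi)
      have hcont : Continuous fun t : ℝ => Q.normal i ⬝ᵥ (x + t • v) + Q.offset i := by fun_prop
      exact (hcont.continuousAt.eventually (lt_mem_nhds hpos)).mono fun t ht => le_of_lt ht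
  obtain ⟨ε, hε, hball⟩ := Metric.eventually_nhds_iff.1 hev
  have h1 : x + (ε / 2) • v ∈ Q.polytope := hball (by
    rw [Real.dist_eq, sub_zero, abs_of_pos (by positivity)]; linarith)
  have h2 : x + (-(ε / 2)) • v ∈ Q.polytope := hball (by
    rw [Real.dist_eq, sub_zero, abs_neg, abs_of_pos (by positivity)]; linarith)
  have hseg : x ∈ openSegment ℝ (x + (ε / 2) • v) (x + (-(ε / 2)) • v) :=
    ⟨1 / 2, 1 / 2, by norm_num, by norm_num, by norm_num, by
      ext k
      simp
      ring⟩
  have h3 := ((mem_extremePoints.1 hx).2 _ h1 _ h2 hseg).1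
  have h4 : (ε / 2) • v = 0 := by simpa using h3
  rcases smul_eq_zero.1 h4 with h5 | h5
  · linarith
  · exact hv h5

theorem isUnit_det {I : Fin n → Fin m} (hI : Q.IsVertexTuple I) :
    IsUnit (Q.charMatrix.submatrix id I).det := by
  obtain ⟨x, hx, hrange⟩ := hI
  exact Q.unimodular x hx I hrange

theorem injective_of_isVertexTuple {I : Fin n → Fin m} (hI : Q.IsVertexTuple I) :
    Function.Injective I := by
  intro k l h
  by_contra hne
  have := Q.isUnit_det hI
  rw [Matrix.det_zero_of_column_eq hne (fun r => by simp [h])] at this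
  exact not_isUnit_zero this

/-- The linear relation by which a class belonging to a facet through a vertex is expressed by the
classes belonging to the facets that do not contain the vertex. -/
theorem cls_eq_sum {I : Fin n → Fin m} (hI : Q.IsVertexTuple I) (k : Fin n) :
    Q.cls (I k) = ∑ j ∈ Finset.univ.filter (fun j => j ∉ Set.range I),
      (((-((Q.charMatrix.submatrix id I).det *
        (Q.charMatrix.submatrix id (Function.update I k j)).det) : ℤ) : ℝ)) • Q.cls j := by
  classical
  have hrow : ∀ r : Fin n, ∑ j, (Q.charMatrix r j : ℝ) • Q.cls j = 0 := by
    intro r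
    have h1 : (∑ j, MvPolynomial.C (Q.charMatrix r j : ℝ) * MvPolynomial.X j :
        MvPolynomial (Fin m) ℝ) ∈ Q.relations :=
      Ideal.mem_sup_right (Ideal.subset_span ⟨r, rfl⟩)
    have h2 := Ideal.Quotient.eq_zero_iff_mem.2 h1
    rw [map_sum] at h2
    rw [← h2]
    refine Finset.sum_congr rfl fun j _ => ?_
    rw [← MvPolynomial.smul_eq_C_mul]
    rfl
  have hupd : ∀ j, (Q.charMatrix.submatrix id (Function.update I k j)).det =
      ∑ r, (Q.charMatrix.submatrix id I).adjugate k r * Q.charMatrix r j := by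
    intro j
    have h1 := congrFun (Matrix.cramer_eq_adjugate_mulVec (Q.charMatrix.submatrix id I)
      (fun r => Q.charMatrix r j)) k
    rw [Matrix.cramer_apply] at h1
    have h2 : Q.charMatrix.submatrix id (Function.update I k j) =
        (Q.charMatrix.submatrix id I).updateCol k (fun r => Q.charMatrix r j) := by
      ext r l
      by_cases hl : l = k
      · subst hl
        simp
      · simp [hl]
    rw [h2, h1]
    rfl
  have hall : ∑ j, ((Q.charMatrix.submatrix id (Function.update I k j)).det : ℝ) • Q.cls j = 0 := by
    have h3 : ∀ j, ((Q.charMatrix.submatrix id (Function.update I k j)).det : ℝ) • Q.cls j =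
        ∑ r, ((Q.charMatrix.submatrix id I).adjugate k r : ℝ) •
          ((Q.charMatrix r j : ℝ) • Q.cls j) := by
      intro j
      rw [hupd, Int.cast_sum, Finset.sum_smul]
      refine Finset.sum_congr rfl fun r _ => ?_
      rw [Int.cast_mul, mul_smul]
    simp only [h3]
    rw [Finset.sum_comm]
    refine Finset.sum_eq_zero fun r _ => ?_
    rw [← Finset.smul_sum, hrow, smul_zero]
  have hinj := Q.injective_of_isVertexTuple hI
  rw [← Finset.sum_filter_add_sum_filter_not _ (fun j => j ∉ Set.range I)] at hall
  have hrest : ∑ j ∈ Finset.univ.filter (fun j => ¬ j ∉ Set.range I),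
      ((Q.charMatrix.submatrix id (Function.update I k j)).det : ℝ) • Q.cls j =
      ((Q.charMatrix.submatrix id I).det : ℝ) • Q.cls (I k) := by
    rw [Finset.sum_eq_single (I k)]
    · rw [Function.update_eq_self]
    · intro j hj hne
      have hj2 : j ∈ Set.range I := not_not.1 (Finset.mem_filter.1 hj).2
      obtain ⟨l, rfl⟩ := hj2
      have hlk : l ≠ k := fun h => hne (by rw [h])
      rw [Matrix.det_zero_of_column_eq hlk (fun r => by simp [hlk])]
      simp
    · intro h
      exact absurd (Finset.mem_filter.2 ⟨Finset.mem_univ (I k), not_not.2 ⟨k, rfl⟩⟩) h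
  rw [hrest] at hall
  have hsq : ((Q.charMatrix.submatrix id I).det : ℝ) * ((Q.charMatrix.submatrix id I).det : ℝ) =
      1 := by
    exact_mod_cast Int.isUnit_mul_self (Q.isUnit_det hI)
  have h4 := eq_neg_of_add_eq_zero_right hall
  have h5 : Q.cls (I k) = ((Q.charMatrix.submatrix id I).det : ℝ) •
      (((Q.charMatrix.submatrix id I).det : ℝ) • Q.cls (I k)) := by
    rw [smul_smul, hsq, one_smul]
  rw [h5, h4, smul_neg, Finset.smul_sum, ← Finset.sum_neg_distrib]
  refine Finset.sum_congr rfl fun j _ => ?_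
  rw [smul_smul, ← neg_smul]
  push_cast
  rfl

end CharacteristicPair

end VolumePolynomial

namespace VolumePolynomial

open CoeffPoly SignFormula

/-! ### Intersection numbers and volume polynomials -/

/-- A vertex in the list that lies on all facets of the word `w`. -/
def findVertex (vs : List (List ℕ × Bool)) (w : List ℕ) : Option (List ℕ × Bool) :=
  vs.find? fun e => w.all fun i => decide (i ∈ e.1)

/-- A facet that occurs in the word `w` repeatedly. -/
def findRepeated (w : List ℕ) : Option ℕ := w.find? fun i => decide (2 ≤ w.count i)

/-- The letter `i` in the word `u` is replaced by `j`. -/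
def replaceLetter (i j : ℕ) (u : List ℕ) : List ℕ := u.map fun a => if a = i then j else a

/-- The coefficient of the class with index `j` in the linear relation at the vertex `u` that
expresses the class with index `i`. -/
def exchangeCoeff (Λ : List (List ℤ)) (u : List ℕ) (i j : ℕ) : ℤ :=
  -(columnDet Λ u * columnDet Λ (replaceLetter i j u))

/-- The number `t.1` times the product of the classes in the word `t.2`, rewritten as a combination
of words: a word without repetitions is kept; another one is zero if its facets do not meet, and
otherwise one occurrence of a repeated class is replaced, by the linear relation at a vertex, by the
classes belonging to the facets that do not contain the vertex. -/
def expandTerm (m : ℕ) (vs : List (List ℕ × Bool)) (Λ : List (List ℤ)) (t : ℤ × List ℕ) :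
    List (ℤ × List ℕ) :=
  (findRepeated t.2).elim [t] fun i => (findVertex vs t.2).elim [] fun e =>
    ((List.range m).filter fun j => decide (¬ j ∈ e.1)).map fun j =>
      (t.1 * exchangeCoeff Λ e.1 i j, t.2.set (t.2.idxOf i) j)

/-- The number `t.1` times the intersection number of the facets in the word `t.2`, if no facet
occurs twice. -/
def termValue (vs : List (List ℕ × Bool)) (Λ : List (List ℤ)) (t : ℤ × List ℕ) : ℤ :=
  (findVertex vs t.2).elim 0 fun e => t.1 * ((if e.2 = true then 1 else -1) * columnDet Λ e.1)

/-- The value of the product of the classes in the word `w` on the fundamental class. As every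
expansion increases the number of different letters, there are no repetitions after `n` steps. -/
def intersectionNumber (n m : ℕ) (vs : List (List ℕ × Bool)) (Λ : List (List ℤ)) (w : List ℕ) :
    ℤ :=
  (((fun L => L.flatMap fun t => expandTerm m vs Λ t)^[n] [(1, w)]).map
    fun t => termValue vs Λ t).sum

/-- The volume polynomial multiplied by `n!`, with one term for every word of length `n`. -/
def volumeCode (n m : ℕ) (vs : List (List ℕ × Bool)) (Λ : List (List ℤ)) : PolyCode :=
  (words (List.range m) n).map fun w =>
    ((List.range m).map fun i => w.count i, intersectionNumber n m vs Λ w, 0)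

section Primrec

variable {α : Type*} [Primcodable α]

@[fun_prop]
theorem findVertex_primrec (vs : α → List (List ℕ × Bool)) (w : α → List ℕ) (hvs : Primrec vs)
    (hw : Primrec w) : Primrec (fun x => findVertex (vs x) (w x)) := by
  unfold findVertex; fun_prop

@[fun_prop]
theorem findRepeated_primrec (w : α → List ℕ) (hw : Primrec w) :
    Primrec (fun x => findRepeated (w x)) := by
  unfold findRepeated; fun_prop

@[fun_prop]
theorem replaceLetter_primrec (i j : α → ℕ) (u : α → List ℕ) (hi : Primrec i) (hj : Primrec j)
    (hu : Primrec u) : Primrec (fun x => replaceLetter (i x) (j x) (u x)) := by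
  unfold replaceLetter; fun_prop

@[fun_prop]
theorem exchangeCoeff_primrec (Λ : α → List (List ℤ)) (u : α → List ℕ) (i j : α → ℕ)
    (hΛ : Primrec Λ) (hu : Primrec u) (hi : Primrec i) (hj : Primrec j) :
    Primrec (fun x => exchangeCoeff (Λ x) (u x) (i x) (j x)) := by
  unfold exchangeCoeff; fun_prop

@[fun_prop]
theorem expandTerm_primrec (m : α → ℕ) (vs : α → List (List ℕ × Bool)) (Λ : α → List (List ℤ))
    (t : α → ℤ × List ℕ) (hm : Primrec m) (hvs : Primrec vs) (hΛ : Primrec Λ) (ht : Primrec t) :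
    Primrec (fun x => expandTerm (m x) (vs x) (Λ x) (t x)) := by
  unfold expandTerm; fun_prop

@[fun_prop]
theorem termValue_primrec (vs : α → List (List ℕ × Bool)) (Λ : α → List (List ℤ))
    (t : α → ℤ × List ℕ) (hvs : Primrec vs) (hΛ : Primrec Λ) (ht : Primrec t) :
    Primrec (fun x => termValue (vs x) (Λ x) (t x)) := by
  unfold termValue; fun_prop

@[fun_prop]
theorem intersectionNumber_primrec (n m : α → ℕ) (vs : α → List (List ℕ × Bool))
    (Λ : α → List (List ℤ)) (w : α → List ℕ) (hn : Primrec n) (hm : Primrec m)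
    (hvs : Primrec vs) (hΛ : Primrec Λ) (hw : Primrec w) :
    Primrec (fun x => intersectionNumber (n x) (m x) (vs x) (Λ x) (w x)) := by
  unfold intersectionNumber; fun_prop

@[fun_prop]
theorem volumeCode_primrec (n m : α → ℕ) (vs : α → List (List ℕ × Bool))
    (Λ : α → List (List ℤ)) (hn : Primrec n) (hm : Primrec m) (hvs : Primrec vs)
    (hΛ : Primrec Λ) : Primrec (fun x => volumeCode (n x) (m x) (vs x) (Λ x)) := by
  unfold volumeCode; fun_prop

end Primrec

theorem findRepeated_eq_none {w : List ℕ} : findRepeated w = none ↔ w.Nodup := by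
  rw [findRepeated, List.find?_eq_none, List.nodup_iff_count_le_one]
  constructor
  · intro h a
    by_cases ha : a ∈ w
    · have := h a ha
      simp only [decide_eq_true_eq] at this
      omega
    · rw [List.count_eq_zero_of_not_mem ha]
      omega
  · intro h a _
    have := h a
    simp only [decide_eq_true_eq]
    omega

theorem set_idxOf_perm {w : List ℕ} {i : ℕ} (hi : i ∈ w) (j : ℕ) :
    (w.set (w.idxOf i) j).Perm (j :: w.erase i) := by
  rw [List.erase_eq_eraseIdx_of_idxOf rfl]
  exact List.set_perm_cons_eraseIdx (List.idxOf_lt_length_iff.2 hi) j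

@[to_additive]
theorem prod_map_count {M : Type*} [CommMonoid M] {m : ℕ} (f : ℕ → M) {w : List ℕ}
    (hw : ∀ a ∈ w, a < m) : (w.map f).prod = ∏ i : Fin m, f i ^ w.count (i : ℕ) := by
  induction w with
  | nil => simp
  | cons a w ih =>
    rw [List.map_cons, List.prod_cons, ih fun b hb => hw b (List.mem_cons_of_mem _ hb)]
    simp only [List.count_cons, pow_add, Finset.prod_mul_distrib]
    rw [mul_comm]
    congr 1
    have ha := hw a List.mem_cons_self
    rw [Finset.prod_eq_single ⟨a, ha⟩]
    · simp
    · intro i _ hi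
      have : ¬ a = (i : ℕ) := fun h => hi (Fin.ext h.symm)
      simp [this]
    · simp

namespace CharacteristicPair

variable {n m : ℕ} (Q : CharacteristicPair n m)

/-- The product of the classes belonging to the facets in a word. -/
noncomputable def wordClass (w : List ℕ) : Q.Cohomology :=
  (w.map fun a => if h : a < m then Q.cls ⟨a, h⟩ else 0).prod

theorem wordClass_perm {w w' : List ℕ} (h : w.Perm w') : Q.wordClass w = Q.wordClass w' :=
  (h.map _).prod_eq

theorem wordClass_cons (j : Fin m) (w : List ℕ) :
    Q.wordClass ((j : ℕ) :: w) = Q.cls j * Q.wordClass w := by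
  simp [wordClass]

theorem wordClass_ofFn (w : Fin n → Fin m) :
    Q.wordClass (List.ofFn fun k => (w k : ℕ)) = ∏ k, Q.cls (w k) := by
  rw [wordClass, List.map_ofFn, List.prod_ofFn]
  simp

theorem wordClass_eq_mk {w : List ℕ} (hw : ∀ a ∈ w, a < m) :
    Q.wordClass w = Ideal.Quotient.mk Q.relations
      (∏ i : Fin m, MvPolynomial.X i ^ w.count (i : ℕ)) := by
  rw [wordClass, prod_map_count _ hw, map_prod]
  refine Finset.prod_congr rfl fun i _ => ?_
  simp [cls]

/-- The product of classes belonging to facets without a common vertex vanishes. -/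
theorem wordClass_eq_zero {vs : List (List ℕ × Bool)} (hvs : Q.IsVertexList vs) {w : List ℕ}
    (hw : ∀ a ∈ w, a < m) (h : findVertex vs w = none) : Q.wordClass w = 0 := by
  classical
  rw [Q.wordClass_eq_mk hw, Ideal.Quotient.eq_zero_iff_mem]
  let S : Finset (Fin m) := Finset.univ.filter fun i => (i : ℕ) ∈ w
  have hS : (Q.polytope ∩ ⋂ i ∈ S, Q.facetSet i) = ∅ := by
    by_contra hne
    obtain ⟨x, hx, hxS⟩ := Q.exists_vertex_of_face S (Set.nonempty_iff_ne_empty.2 hne)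
    obtain ⟨e, he, I, hI, heI⟩ := hvs.2 x hx
    refine List.find?_eq_none.1 h e he ?_
    rw [List.all_eq_true]
    intro a ha
    have h1 := hxS ⟨a, hw a ha⟩ (Finset.mem_filter.2 ⟨Finset.mem_univ _, ha⟩)
    rw [← hI] at h1
    obtain ⟨k, hk⟩ := h1
    rw [decide_eq_true_iff, heI, List.mem_ofFn]
    exact ⟨k, by rw [hk]⟩
  have hmem : (∏ i ∈ S, MvPolynomial.X i : MvPolynomial (Fin m) ℝ) ∈ Q.relations :=
    Ideal.mem_sup_left (Ideal.subset_span ⟨S, hS, rfl⟩)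
  refine Ideal.mem_of_dvd _ ?_ hmem
  have h1 : (∏ i : Fin m, MvPolynomial.X i ^ w.count (i : ℕ) : MvPolynomial (Fin m) ℝ) =
      ∏ i ∈ S, MvPolynomial.X i ^ w.count (i : ℕ) := by
    refine (Finset.prod_subset (Finset.subset_univ S) fun i _ hi => ?_).symm
    have : (i : ℕ) ∉ w := fun h => hi (Finset.mem_filter.2 ⟨Finset.mem_univ _, h⟩)
    rw [List.count_eq_zero_of_not_mem this, pow_zero]
  rw [h1]
  refine Finset.prod_dvd_prod_of_dvd _ _ fun i hi => dvd_pow_self _ ?_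
  have : (i : ℕ) ∈ w := (Finset.mem_filter.1 hi).2
  exact (List.count_pos_iff.2 this).ne'

theorem findVertex_eq_some {vs : List (List ℕ × Bool)} (hvs : Q.IsVertexList vs) {w : List ℕ}
    {e : List ℕ × Bool} (h : findVertex vs w = some e) :
    (∀ a ∈ w, a ∈ e.1) ∧ ∃ I : Fin n → Fin m, Q.IsVertexTuple I ∧
      e.1 = List.ofFn (fun k => (I k : ℕ)) ∧ (e.2 = true ↔ 0 < Q.normalDet I) := by
  refine ⟨?_, hvs.1 e (List.mem_of_find?_eq_some h)⟩
  have := List.find?_some h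
  simpa [List.all_eq_true] using this

/-- One expansion step does not change the value of a linear functional, and it produces words
with more different letters unless there is no repetition. -/
theorem expandTerm_spec {vs : List (List ℕ × Bool)} (hvs : Q.IsVertexList vs)
    (φ : Q.Cohomology →ₗ[ℝ] ℝ) (t : ℤ × List ℕ) (ht : ∀ a ∈ t.2, a < m) :
    ((expandTerm m vs (List.ofFn fun i => List.ofFn fun j => Q.charMatrix i j) t).map
        fun s => (s.1 : ℝ) * φ (Q.wordClass s.2)).sum = t.1 * φ (Q.wordClass t.2) ∧
      ∀ s ∈ expandTerm m vs (List.ofFn fun i => List.ofFn fun j => Q.charMatrix i j) t,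
        s.2.length = t.2.length ∧ (∀ a ∈ s.2, a < m) ∧
          (s.2.Nodup ∨ t.2.toFinset.card + 1 ≤ s.2.toFinset.card) := by
  classical
  rw [expandTerm]
  rcases hrep : findRepeated t.2 with _ | i
  · simp only [Option.elim_none]
    refine ⟨by simp, fun s hs => ?_⟩
    rw [List.mem_singleton] at hs
    subst hs
    exact ⟨rfl, ht, Or.inl (findRepeated_eq_none.1 hrep)⟩
  simp only [Option.elim_some]
  rcases hver : findVertex vs t.2 with _ | e
  · simp only [Option.elim_none]
    rw [Q.wordClass_eq_zero hvs ht hver]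
    simp
  simp only [Option.elim_some]
  obtain ⟨hsub, I, hI, heI, -⟩ := Q.findVertex_eq_some hvs hver
  have hit : i ∈ t.2 := List.mem_of_find?_eq_some hrep
  have hcount : 2 ≤ t.2.count i := by
    have := List.find?_some hrep
    simpa using this
  obtain ⟨k, hk⟩ := List.mem_ofFn.1 (heI ▸ hsub i hit)
  have hinj := Q.injective_of_isVertexTuple hI
  have hnot : ∀ j : Fin m, (j : ℕ) ∉ e.1 ↔ j ∉ Set.range I := by
    intro j
    rw [heI, List.mem_ofFn]
    simp only [Set.mem_range, Fin.ext_iff]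
  have hdet : ∀ j : Fin m, columnDet (List.ofFn fun i => List.ofFn fun j => Q.charMatrix i j)
      (replaceLetter i j e.1) =
      (Q.charMatrix.submatrix id (Function.update I k j)).det := by
    intro j
    rw [← columnDet_eq, replaceLetter, heI, List.map_ofFn]
    congr 2
    funext l
    by_cases hl : l = k
    · subst hl
      simp [hk]
    · have : ¬ (I l : ℕ) = i := by
        rw [← hk, ← Fin.ext_iff]
        exact fun h => hl (hinj h)
      simp [hl, this]
  constructor
  · have h1 : Q.wordClass t.2 = Q.cls (I k) * Q.wordClass (t.2.erase i) := by
      rw [← wordClass_cons, hk]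
      exact Q.wordClass_perm (List.perm_cons_erase hit)
    have h2 : ∀ j : Fin m, Q.wordClass (t.2.set (t.2.idxOf i) j) =
        Q.cls j * Q.wordClass (t.2.erase i) := by
      intro j
      rw [← wordClass_cons]
      exact Q.wordClass_perm (set_idxOf_perm hit j)
    have h3 : ∀ F : ℕ → ℝ, (((List.range m).filter fun j => decide (¬ j ∈ e.1)).map F).sum =
        ∑ j ∈ Finset.univ.filter (fun j : Fin m => j ∉ Set.range I), F j := by
      intro F
      have h4 : (((List.range m).filter fun j => decide (¬ j ∈ e.1)).map F).sum =
          ((List.range m).map fun j => if j ∈ e.1 then 0 else F j).sum := by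
        generalize List.range m = l
        induction l with
        | nil => rfl
        | cons a l ih =>
          by_cases ha : a ∈ e.1 <;> simp_all
      rw [h4, Finset.sum_filter, ← List.sum_toFinset _ List.nodup_range, List.toFinset_range,
        Finset.sum_range]
      refine Finset.sum_congr rfl fun j _ => ?_
      by_cases hj : (j : ℕ) ∈ e.1
      · rw [if_pos hj, if_neg]
        rw [← hnot]
        exact not_not.2 hj
      · rw [if_neg hj, if_pos ((hnot j).1 hj)]
    rw [List.map_map, h3, h1, Q.cls_eq_sum hI k, Finset.sum_mul, map_sum, Finset.mul_sum]
    refine Finset.sum_congr rfl fun j _ => ?_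
    simp only [Function.comp_apply]
    rw [exchangeCoeff, hdet, h2, smul_mul_assoc, map_smul, smul_eq_mul]
    have h5 : columnDet (List.ofFn fun i => List.ofFn fun j => Q.charMatrix i j) e.1 =
        (Q.charMatrix.submatrix id I).det := by
      rw [heI, columnDet_eq]
    rw [h5]
    push_cast
    ring
  · intro s hs
    obtain ⟨j, hj, rfl⟩ := List.mem_map.1 hs
    rw [List.mem_filter, List.mem_range, decide_eq_true_iff] at hj
    have hperm := set_idxOf_perm hit j
    refine ⟨by simp, fun a ha => ?_, Or.inr ?_⟩
    · rcases List.mem_cons.1 (hperm.mem_iff.1 ha) with rfl | ha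
      · exact hj.1
      · exact ht a (List.mem_of_mem_erase ha)
    · -- all letters of the word belong to facets through the vertex, so the letter `j` is new
      have hjt : j ∉ t.2 := fun h => hj.2 (hsub j h)
      have h6 : insert j t.2.toFinset ⊆ (t.2.set (t.2.idxOf i) j).toFinset := by
        intro a ha
        rw [List.mem_toFinset, hperm.mem_iff, List.mem_cons]
        rcases Finset.mem_insert.1 ha with rfl | ha
        · exact Or.inl rfl
        · refine Or.inr ?_
          rw [List.mem_toFinset] at ha
          rw [← List.count_pos_iff, List.count_erase]
          have := List.count_pos_iff.2 ha
          by_cases hai : i = a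
          · subst hai
            simp
            omega
          · simp [hai, ha]
      have h7 := Finset.card_le_card h6
      rwa [Finset.card_insert_of_notMem (by simpa using hjt)] at h7

theorem termValue_spec {vs : List (List ℕ × Bool)} (hvs : Q.IsVertexList vs)
    {φ : Q.Cohomology →ₗ[ℝ] ℝ} (hφ : Q.IsFundamentalClass φ) (t : ℤ × List ℕ)
    (ht : ∀ a ∈ t.2, a < m) (hlen : t.2.length = n) (hnd : t.2.Nodup) :
    (termValue vs (List.ofFn fun i => List.ofFn fun j => Q.charMatrix i j) t : ℝ) =
      t.1 * φ (Q.wordClass t.2) := by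
  rw [termValue]
  rcases hver : findVertex vs t.2 with _ | e
  · rw [Q.wordClass_eq_zero hvs ht hver]
    simp
  obtain ⟨hsub, I, hI, heI, hsign⟩ := Q.findVertex_eq_some hvs hver
  have hperm : t.2.Perm e.1 := by
    refine (List.subperm_of_subset hnd hsub).perm_of_length_le ?_
    rw [heI, List.length_ofFn, hlen]
  rw [Q.wordClass_perm hperm, heI, wordClass_ofFn, hφ.vertex I hI, fixedPointSign, Option.elim_some,
    heI, columnDet_eq]
  push_cast
  congr 2
  by_cases h : e.2 = true
  · rw [if_pos h, Real.sign_of_pos (hsign.1 h)]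
  · rw [if_neg h, Real.sign_of_neg]
    exact lt_of_le_of_ne (not_lt.1 fun h' => h (hsign.2 h')) (Q.normalDet_ne_zero hI)

theorem intersectionNumber_spec {vs : List (List ℕ × Bool)} (hvs : Q.IsVertexList vs)
    {φ : Q.Cohomology →ₗ[ℝ] ℝ} (hφ : Q.IsFundamentalClass φ) {w : List ℕ}
    (hw : ∀ a ∈ w, a < m) (hlen : w.length = n) :
    (intersectionNumber n m vs (List.ofFn fun i => List.ofFn fun j => Q.charMatrix i j) w : ℝ) =
      φ (Q.wordClass w) := by
  set Λ := List.ofFn fun i => List.ofFn fun j => Q.charMatrix i j with hΛ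
  have key : ∀ N : ℕ,
      ((((fun L => L.flatMap fun t => expandTerm m vs Λ t)^[N] [(1, w)]).map
        fun s => (s.1 : ℝ) * φ (Q.wordClass s.2)).sum = φ (Q.wordClass w)) ∧
      ∀ s ∈ (fun L => L.flatMap fun t => expandTerm m vs Λ t)^[N] [(1, w)],
        s.2.length = n ∧ (∀ a ∈ s.2, a < m) ∧ (s.2.Nodup ∨ N ≤ s.2.toFinset.card) := by
    intro N
    induction N with
    | zero =>
      refine ⟨by simp, fun s hs => ?_⟩
      obtain rfl := List.mem_singleton.1 hs
      exact ⟨hlen, hw, Or.inr (Nat.zero_le _)⟩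
    | succ N ih =>
      rw [Function.iterate_succ_apply']
      set L := (fun L => L.flatMap fun t => expandTerm m vs Λ t)^[N] [(1, w)]
      obtain ⟨ih1, ih2⟩ := ih
      constructor
      · rw [← ih1, List.map_flatMap, List.flatMap, List.sum_flatten, List.map_map]
        congr 1
        refine List.map_congr_left fun t ht => ?_
        exact (Q.expandTerm_spec hvs φ t (ih2 t ht).2.1).1
      · intro s hs
        obtain ⟨t, ht, hst⟩ := List.mem_flatMap.1 hs
        obtain ⟨h1, h2, h3⟩ := ih2 t ht
        obtain ⟨h4, h5, h6⟩ := (Q.expandTerm_spec hvs φ t h2).2 s hst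
        refine ⟨h4.trans h1, h5, ?_⟩
        rcases h3 with h3 | h3
        · left
          rw [expandTerm, findRepeated_eq_none.2 h3] at hst
          obtain rfl := List.mem_singleton.1 hst
          exact h3
        · exact h6.imp id fun h => by omega
  obtain ⟨h1, h2⟩ := key n
  rw [← h1, intersectionNumber, Int.cast_list_sum, List.map_map]
  congr 1
  refine List.map_congr_left fun s hs => ?_
  obtain ⟨h3, h4, h5⟩ := h2 s hs
  refine Q.termValue_spec hvs hφ s h4 h3 ?_
  rcases h5 with h5 | h5
  · exact h5
  · have h6 : s.2.dedup.length = s.2.length := by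
      rw [List.card_toFinset] at h5
      exact le_antisymm (List.dedup_sublist _).length_le (by omega)
    rw [← List.dedup_eq_self]
    exact (List.dedup_sublist _).eq_of_length h6

/-- Expansion of `(∑ cᵢ xᵢ)ⁿ` gives `n! V` as the sum, over all words of length `n`, of intersection
numbers times monomials. -/
theorem toPoly_volumeCode {vs : List (List ℕ × Bool)} (hvs : Q.IsVertexList vs)
    {V : MvPolynomial (Fin m) ℝ} (hV : Q.IsVolumePolynomial V) :
    (volumeCode n m vs (List.ofFn fun i => List.ofFn fun j => Q.charMatrix i j)).toPoly m =
      (n.factorial : ℝ) • V := by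
  obtain ⟨φ, hφ, hVφ⟩ := hV
  refine MvPolynomial.funext fun c => ?_
  rw [MvPolynomial.smul_eval, hVφ, Fintype.sum_pow, map_sum, ← mul_assoc,
    mul_one_div_cancel (by positivity), one_mul, volumeCode, PolyCode.toPoly,
    List.map_map, sum_words, map_sum]
  refine Finset.sum_congr rfl fun w _ => ?_
  have hlt : ∀ a ∈ List.ofFn fun k => (w k : ℕ), a < m := by
    intro a ha
    obtain ⟨k, rfl⟩ := List.mem_ofFn.1 ha
    exact (w k).2
  simp only [Function.comp_apply, MvPolynomial.eval_monomial]
  rw [Q.intersectionNumber_spec hvs hφ hlt (by simp), wordClass_ofFn]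
  have h1 : ∏ k, c (w k) • Q.cls (w k) = (∏ k, c (w k)) • ∏ k, Q.cls (w k) := by
    induction (Finset.univ : Finset (Fin n)) using Finset.induction_on with
    | empty => simp
    | insert k s hk ih =>
      rw [Finset.prod_insert hk, Finset.prod_insert hk, Finset.prod_insert hk, ih,
        smul_mul_smul_comm]
  have h2 : ((exponent m ((List.range m).map fun i => (List.ofFn fun k => (w k : ℕ)).count i)).prod
      fun i e => c i ^ e) = ∏ k, c (w k) := by
    have h3 := prod_map_count (fun a => if h : a < m then c ⟨a, h⟩ else 0) hlt
    rw [List.map_ofFn, List.prod_ofFn] at h3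
    rw [Finsupp.prod_fintype _ _ (by simp)]
    simp only [Function.comp_apply, Fin.is_lt, dite_true, Fin.eta] at h3
    rw [h3]
    refine Finset.prod_congr rfl fun i _ => ?_
    simp [exponent_apply]
  rw [h1, h2, map_smul, smul_eq_mul]
  simp
  ring

theorem isHomogeneous_volumeCode (vs : List (List ℕ × Bool)) (Λ : List (List ℤ)) :
    ((volumeCode n m vs Λ).toPoly m).IsHomogeneous n := by
  rw [PolyCode.toPoly]
  refine list_sum_mem (S := MvPolynomial.homogeneousSubmodule (Fin m) ℝ n) fun p hp => ?_
  obtain ⟨t, ht, rfl⟩ := List.mem_map.1 hp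
  obtain ⟨w, hw, rfl⟩ := List.mem_map.1 ht
  rw [mem_words] at hw
  refine MvPolynomial.isHomogeneous_monomial _ ?_
  rw [degree_exponent (by simp), list_sum_map_range, ← hw.1]
  simpa using (sum_map_count (fun _ => (1 : ℕ)) fun a ha => List.mem_range.1 (hw.2 a ha)).symm

end CharacteristicPair

end VolumePolynomial

theorem mainTheorem11 :
    -- uniformly in a real form: the condition is equivalent to a sign condition on the
    -- coefficients, which is computed from the number of variables and the degree
    (∃ Φ : ℕ × ℕ → VolumePolynomial.SignFormula, Computable Φ ∧
      ∀ (m d : ℕ) (V : MvPolynomial (Fin m) ℝ), V.IsHomogeneous d →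
        ((Φ (m, d)).Holds V ↔ VolumePolynomial.DerivativesChangeSign d V)) ∧
    -- for forms with rational coefficients the condition is decidable
    (∃ f : ℕ × ℕ × VolumePolynomial.PolyCode → Bool, Computable f ∧
      ∀ (m d : ℕ) (c : VolumePolynomial.PolyCode), (c.toPoly m).IsHomogeneous d →
        (f (m, d, c) = true ↔ VolumePolynomial.DerivativesChangeSign d (c.toPoly m))) ∧
    -- for the volume polynomials of quasitoric manifolds the condition is decidable
    (∃ g : VolumePolynomial.CharacteristicPair.Code → Bool, Computable g ∧
      ∀ (n m : ℕ) (Q : VolumePolynomial.CharacteristicPair n m)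
        (c : VolumePolynomial.CharacteristicPair.Code), Q.IsCode c →
        ∀ V : MvPolynomial (Fin m) ℝ, Q.IsVolumePolynomial V →
          (g c = true ↔ VolumePolynomial.DerivativesChangeSign n V)) := by
  refine ⟨⟨fun x => VolumePolynomial.changeSignFormula x.1 x.2, Primrec.to_comp ?_,
    fun m d V hV => VolumePolynomial.holds_changeSignFormula hV⟩,
    ⟨fun x => VolumePolynomial.PolyCode.decideChangeSign x.1 x.2.1 x.2.2, Primrec.to_comp ?_,
      fun m d c hc => VolumePolynomial.PolyCode.decideChangeSign_iff hc⟩,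
    ⟨fun x => VolumePolynomial.PolyCode.decideChangeSign x.2.1 x.1
      (VolumePolynomial.volumeCode x.1 x.2.1 x.2.2.1 x.2.2.2), Primrec.to_comp ?_, ?_⟩⟩
  · fun_prop
  · fun_prop
  · fun_prop
  · rintro n m Q _ ⟨vs, hvs, rfl⟩ V hV
    dsimp only
    rw [VolumePolynomial.PolyCode.decideChangeSign_iff
      (VolumePolynomial.CharacteristicPair.isHomogeneous_volumeCode vs _),
      Q.toPoly_volumeCode hvs hV, VolumePolynomial.derivativesChangeSign_smul (by positivity)]
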